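/- Let $r_1\ge 1$, let $A,R$ be real $r_1\times r_1$ matrices, $C$ a real $r_2\times r_1$ matrix and $R_2$ a real $r_2\times r_2$ matrix, with $R$ and $R_2$ symmetric positive definite, and put $S=C'R_2^{-1}C$ and $\mathrm{Ricc}(Q)=AQ+QA'-QSQ+R$. Let $\Vert\cdot\Vert_2$ be the operator norm induced by the Euclidean norm, $\mu(M)=\inf\{\alpha:\langle x,Mx\rangle\le\alpha\Vert x\Vert^2\ \forall x\}$ the logarithmic norm, and $\varsigma(M)=\max\{\mathrm{Re}\,\lambda:\lambda\in\mathrm{Spec}(M)\}$ the spectral abscissa. Assume uniform observability and controllability: for some $\upsilon,\varpi_-,\varpi_+>0$, in the Loewner order, $$\varpi_-Id\le\int_0^\upsilon e^{As}Re^{A's}\,ds\le\varpi_+Id,\qquad \varpi_-Id\le\int_0^\upsilon e^{-A's}Se^{-As}\,ds\le\varpi_+Id .$$ Then the equation $\mathrm{Ricc}(P)=0$ has a unique symmetric positive semi-definite solution $P$, one has $\varsigma(A-PS)<0$, and the following holds. (1) There are $\beta>0$ and a real function $\alpha(\cdot,\cdot)$ of pairs of matrices such that for all solutions $P_t,\check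 P_t$, $t\ge 0$, of $\partial_tP_t=\mathrm{Ricc}(P_t)$ with symmetric positive semi-definite initial values $P_0,\check P_0$, $$\Vert P_t-\check P_t\Vert_2\le\alpha(P_0,\check P_0)\,e^{-2\beta t}\,\Vert P_0-\check P_0\Vert_2\qquad(t\ge0);\tag{B}$$ and for each $\epsilon\in\,]0,1]$ there is a constant $\kappa(\epsilon)$ such that $$\Vert e^{t(A-PS)}\Vert_2\le\kappa(\epsilon)\,e^{(1-\epsilon)\varsigma(A-PS)t}\qquad(t\ge0).\tag{E}$$ (2) For every $(\alpha,\beta)$ with $\beta>0$ satisfying (B) for all such pairs of solutions, every $\epsilon\in\,]0,1]$, every $\kappa(\epsilon)$ satisfying (E), all solutions $P_t,\check P_t$ as above and all $t\ge 0$, $$\Vert P_t-\check P_t\Vert_2\le\overline\kappa_{\epsilon,\varsigma}(P_0)\,\overline\kappa_{\epsilon,\varsigma}(\check P_0)\,e^{2(1-\epsilon)\varsigma(A-PS)t}\,\Vert P_0-\check P_0\Vert_2,$$ $$\Vert P_t-\check P_t\Vert_2\le\overline\kappa_{\mu}(P_0)\,\overline\kappa_{\mu}(\check P_0)\,e^{2\mu(A-PS)t}\,\Vert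 P_0-\check P_0\Vert_2,$$ where $$\overline\kappa_\mu(Q)=\exp\Big(\frac{\Vert Q-P\Vert_2\Vert S\Vert_2\,\alpha(Q,P)}{2\beta}\Big),\qquad \overline\kappa_{\epsilon,\varsigma}(Q)=\kappa(\epsilon)\exp\Big(\kappa(\epsilon)\,\frac{\Vert Q-P\Vert_2\Vert S\Vert_2\,\alpha(Q,P)}{2\beta}\Big).$$ -/

import Mathlib

open scoped Matrix Matrix.Norms.L2Operator

noncomputable section

namespace KalmanBucy

/- Throughout, `‖·‖` on matrices is the operator norm induced by the Euclidean norms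
(the scoped instance of `Matrix.Norms.L2Operator`). -/

/-- The logarithmic norm `μ(A) = inf {α : ⟨x, A x⟩ ≤ α ‖x‖² for all x}` of a real square matrix. -/
def logNorm {n : ℕ} (A : Matrix (Fin n) (Fin n) ℝ) : ℝ :=
  sInf {a : ℝ | ∀ x : Fin n → ℝ, x ⬝ᵥ (A *ᵥ x) ≤ a * (x ⬝ᵥ x)}

/-- The spectral abscissa `ς(A) = max {Re λ : λ ∈ Spec(A)}`; the eigenvalues of the real matrix `A`
are its complex ones. -/
def spectralAbscissa {n : ℕ} (A : Matrix (Fin n) (Fin n) ℝ) : ℝ :=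
  sSup (Complex.re '' spectrum ℂ (A.map (fun x : ℝ => (x : ℂ))))

/-- The matrix `S = C' R₂⁻¹ C`. -/
def obsMatrix {m n : ℕ} (C : Matrix (Fin m) (Fin n) ℝ) (R₂ : Matrix (Fin m) (Fin m) ℝ) :
    Matrix (Fin n) (Fin n) ℝ :=
  Cᵀ * R₂⁻¹ * C

/-- The quadratic drift `Ricc(Q) = A Q + Q A' - Q S Q + R`. -/
def ricc {n : ℕ} (A R S Q : Matrix (Fin n) (Fin n) ℝ) : Matrix (Fin n) (Fin n) ℝ :=
  A * Q + Q * Aᵀ - Q * S * Q + R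

/-- `t ↦ P t`, `t ≥ 0`, solves the Riccati differential equation `∂ₜ Pₜ = Ricc(Pₜ)` and starts at a
covariance matrix, i.e. at a symmetric positive semi-definite matrix
(the derivative at `t = 0` is the right derivative). -/
structure IsRiccatiFlow {n : ℕ} (A R S : Matrix (Fin n) (Fin n) ℝ)
    (P : ℝ → Matrix (Fin n) (Fin n) ℝ) : Prop where
  posSemidef_zero : (P 0).PosSemidef
  hasDerivWithinAt : ∀ t : ℝ, 0 ≤ t →
    HasDerivWithinAt P (ricc A R S (P t)) (Set.Ici 0) t

/-- `P` is a positive semi-definite solution of the algebraic Riccati equation `Ricc(P) = 0`. -/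
def IsSteadyState {n : ℕ} (A R S P : Matrix (Fin n) (Fin n) ℝ) : Prop :=
  P.PosSemidef ∧ ricc A R S P = 0

/-- The controllability Gramian `∫₀^υ e^{As} R e^{A's} ds`. -/
def ctrlGramian {n : ℕ} (A R : Matrix (Fin n) (Fin n) ℝ) (υ : ℝ) : Matrix (Fin n) (Fin n) ℝ :=
  ∫ s in (0 : ℝ)..υ, NormedSpace.exp (s • A) * R * NormedSpace.exp (s • Aᵀ)

/-- The observability Gramian `∫₀^υ e^{-A's} S e^{-As} ds`. -/
def obsGramian {n : ℕ} (A S : Matrix (Fin n) (Fin n) ℝ) (υ : ℝ) : Matrix (Fin n) (Fin n) ℝ :=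
  ∫ s in (0 : ℝ)..υ, NormedSpace.exp ((-s) • Aᵀ) * S * NormedSpace.exp ((-s) • A)

/-- Uniform observability and controllability with interval `υ > 0` and bounds `ϖm, ϖp > 0`:
both Gramians lie between `ϖm Id` and `ϖp Id` in the Loewner order. -/
structure UniformlyObservableControllable {n : ℕ} (A R S : Matrix (Fin n) (Fin n) ℝ)
    (υ ϖm ϖp : ℝ) : Prop where
  interval_pos : 0 < υ
  lower_pos : 0 < ϖm
  upper_pos : 0 < ϖp
  ctrl_lower : (ctrlGramian A R υ - ϖm • (1 : Matrix (Fin n) (Fin n) ℝ)).PosSemidef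
  ctrl_upper : (ϖp • (1 : Matrix (Fin n) (Fin n) ℝ) - ctrlGramian A R υ).PosSemidef
  obs_lower : (obsGramian A S υ - ϖm • (1 : Matrix (Fin n) (Fin n) ℝ)).PosSemidef
  obs_upper : (ϖp • (1 : Matrix (Fin n) (Fin n) ℝ) - obsGramian A S υ).PosSemidef

/-- `α(·,·)` and `β > 0` are constants in Bucy's estimate
`‖Pₜ - P̌ₜ‖ ≤ α(P₀, P̌₀) exp(-2 β t) ‖P₀ - P̌₀‖`, for all `t ≥ 0` and all pairs of Riccati flows. -/
def IsBucyConstants {n : ℕ} (A R S : Matrix (Fin n) (Fin n) ℝ)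
    (α : Matrix (Fin n) (Fin n) ℝ → Matrix (Fin n) (Fin n) ℝ → ℝ) (β : ℝ) : Prop :=
  0 < β ∧ ∀ P Q : ℝ → Matrix (Fin n) (Fin n) ℝ, IsRiccatiFlow A R S P → IsRiccatiFlow A R S Q →
    ∀ t : ℝ, 0 ≤ t → ‖P t - Q t‖ ≤ α (P 0) (Q 0) * Real.exp (-(2 * β * t)) * ‖P 0 - Q 0‖

/-- `k` is a constant `κ(ε)` in the (Jordan or Schur type) bound
`‖e^{tM}‖ ≤ κ(ε) exp((1 - ε) ς(M) t)`, `t ≥ 0`. -/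
def IsExpBound {n : ℕ} (M : Matrix (Fin n) (Fin n) ℝ) (ε k : ℝ) : Prop :=
  ∀ t : ℝ, 0 ≤ t → ‖NormedSpace.exp (t • M)‖ ≤ k * Real.exp ((1 - ε) * spectralAbscissa M * t)

/-- `κ̄_μ(Q) = exp(‖Q - P‖ ‖S‖ α(Q, P) / (2 β))`. -/
def kappaMu {n : ℕ} (P S : Matrix (Fin n) (Fin n) ℝ)
    (α : Matrix (Fin n) (Fin n) ℝ → Matrix (Fin n) (Fin n) ℝ → ℝ) (β : ℝ)
    (Q : Matrix (Fin n) (Fin n) ℝ) : ℝ :=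
  Real.exp (‖Q - P‖ * ‖S‖ * α Q P / (2 * β))

/-- `κ̄_{ε,ς}(Q) = k exp(k ‖Q - P‖ ‖S‖ α(Q, P) / (2 β))`, where `k = κ(ε)`. -/
def kappaSigma {n : ℕ} (P S : Matrix (Fin n) (Fin n) ℝ)
    (α : Matrix (Fin n) (Fin n) ℝ → Matrix (Fin n) (Fin n) ℝ → ℝ) (β k : ℝ)
    (Q : Matrix (Fin n) (Fin n) ℝ) : ℝ :=
  k * Real.exp (k * (‖Q - P‖ * ‖S‖ * α Q P / (2 * β)))

end KalmanBucy

end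

/-!
Everything rests on the stability of `M = A - P S`. For a Riccati flow `Pₜ` let `E` be the transition
matrix of `x' = (A - Pₜ S) x`. Two Riccati flows satisfy
`Pₜ - Qₜ = E(P)ₜ (P₀ - Q₀) E(Q)ₜ'` (`IsRiccatiFlow.sub_eq`), since both sides solve the same linear
equation, so it suffices to bound transition matrices. As `A - Pₜ S = M + (P - Pₜ) S`, a Grönwall
argument turns any bound `‖e^{tM}‖ ≤ k e^{lt}` and any exponential bound of `‖Pₜ - P‖` into
`‖E(P)ₜ‖ ≤ k exp (k ∫ ‖Pₜ - P‖ ‖S‖) e^{lt}` (`norm_le_of_perturbed_ode`). Applied with Bucy's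
estimate for the pair `(Pₜ, P)`, the choices `l = (1 - ε) ς(M)` and `k = 1`, `l = μ(M)` give the two
decay estimates (`norm_sub_le_of_isBucyConstants`).

Steady state. Since `R > 0`, Lyapunov's criterion shows that `A - X S` is stable for every positive
semi-definite `X` with `Ricc(X) ≤ 0`. Such `X` exist: the inverse of a discounted observability
Gramian is a stabilizing gain (`exists_stabilizing`), and one Newton step from it produces a
subsolution. A subsolution of least trace, which exists by compactness, is a solution, for otherwise
a further Newton step would lower the trace (`exists_isSteadyState_of_stabilizing`). Two solutions
agree because their difference solves a homogeneous Sylvester equation with stable coefficients.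

Bucy's estimate. The transition matrix and its inverse are read off from the exponential of the
Hamiltonian matrix. With `X = (E')⁻¹` the forms `X' Pₜ X` increase strictly, whence
`Pₜ ≥ δ Eₜ Eₜ'` for `t ≥ 1`; together with `Pₜ - P = Eₜ (P₀ - P) e^{tM'}` this bounds `E`
(`IsRiccatiFlow.exists_norm_transition_le`). Hence `Pₜ → P` exponentially, and the Grönwall argument
gives `E` the decay rate of `e^{tM}`, which does not depend on the initial value.

Existence of `κ(ε)`. Spectral mapping for the exponential and Gelfand's formula show that every
number above `ς(M)` is a growth rate of `e^{tM}` (`exists_norm_exp_le`).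
-/

namespace KalmanBucy

open Set Filter Topology

/-! ### Quadratic forms, operator norms and derivatives of matrix functions -/

section Forms

variable {ι : Type*} [Fintype ι]

lemma dotProduct_self_pos {x : ι → ℝ} (hx : x ≠ 0) : 0 < x ⬝ᵥ x := by
  simpa using Matrix.dotProduct_star_self_pos_iff.2 hx

lemma norm_toLp_sq (x : ι → ℝ) : ‖WithLp.toLp 2 x‖ ^ 2 = x ⬝ᵥ x := by
  rw [EuclideanSpace.real_norm_sq_eq]
  simp [dotProduct, sq]

lemma abs_dotProduct_le (x y : ι → ℝ) :
    |x ⬝ᵥ y| ≤ ‖WithLp.toLp 2 x‖ * ‖WithLp.toLp 2 y‖ := by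
  have := abs_real_inner_le_norm (WithLp.toLp 2 y) (WithLp.toLp 2 x)
  rw [EuclideanSpace.inner_eq_star_dotProduct] at this
  simpa [mul_comm] using this

lemma posSemidef_iff_real {B : Matrix ι ι ℝ} :
    B.PosSemidef ↔ Bᵀ = B ∧ ∀ x : ι → ℝ, 0 ≤ x ⬝ᵥ B *ᵥ x := by
  rw [Matrix.posSemidef_iff_dotProduct_mulVec, Matrix.IsHermitian,
    Matrix.conjTranspose_eq_transpose_of_trivial]
  simp

lemma posDef_iff_real {B : Matrix ι ι ℝ} :
    B.PosDef ↔ Bᵀ = B ∧ ∀ x : ι → ℝ, x ≠ 0 → 0 < x ⬝ᵥ B *ᵥ x := by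
  rw [Matrix.posDef_iff_dotProduct_mulVec, Matrix.IsHermitian,
    Matrix.conjTranspose_eq_transpose_of_trivial]
  simp

lemma dotProduct_mulVec_transpose (B : Matrix ι ι ℝ) (x y : ι → ℝ) :
    x ⬝ᵥ Bᵀ *ᵥ y = (B *ᵥ x) ⬝ᵥ y := by
  rw [Matrix.mulVec_transpose, dotProduct_comm, ← Matrix.dotProduct_mulVec, dotProduct_comm]

variable [DecidableEq ι]

lemma norm_toLp_mulVec_le (B : Matrix ι ι ℝ) (x : ι → ℝ) :
    ‖WithLp.toLp 2 (B *ᵥ x)‖ ≤ ‖B‖ * ‖WithLp.toLp 2 x‖ :=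
  Matrix.l2_opNorm_mulVec B (WithLp.toLp 2 x)

lemma l2_opNorm_le_of_forall_norm_toLp {B : Matrix ι ι ℝ} {c : ℝ} (hc : 0 ≤ c)
    (h : ∀ x : ι → ℝ, ‖WithLp.toLp 2 (B *ᵥ x)‖ ≤ c * ‖WithLp.toLp 2 x‖) : ‖B‖ ≤ c := by
  rw [Matrix.cstar_norm_def]
  exact ContinuousLinearMap.opNorm_le_bound _ hc fun x => h x.ofLp

lemma l2_opNorm_transpose (B : Matrix ι ι ℝ) : ‖Bᵀ‖ = ‖B‖ := by
  rw [← Matrix.conjTranspose_eq_transpose_of_trivial, Matrix.l2_opNorm_conjTranspose]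

lemma abs_dotProduct_mulVec_le (B : Matrix ι ι ℝ) (x y : ι → ℝ) :
    |x ⬝ᵥ B *ᵥ y| ≤ ‖B‖ * (‖WithLp.toLp 2 x‖ * ‖WithLp.toLp 2 y‖) := by
  refine (abs_dotProduct_le _ _).trans ?_
  have := mul_le_mul_of_nonneg_left (norm_toLp_mulVec_le B y) (norm_nonneg (WithLp.toLp 2 x))
  linarith

/-- The continuous linear functional `B ↦ ⟨x, B y⟩`. -/
noncomputable def formCLM (x y : ι → ℝ) : Matrix ι ι ℝ →L[ℝ] ℝ :=
  LinearMap.toContinuousLinearMap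
    { toFun := fun B => x ⬝ᵥ B *ᵥ y
      map_add' := fun B D => by simp [Matrix.add_mulVec]
      map_smul' := fun c B => by simp [Matrix.smul_mulVec] }

/-- Transposition of matrices as a continuous linear map. -/
noncomputable def transposeCLM : Matrix ι ι ℝ →L[ℝ] Matrix ι ι ℝ :=
  LinearMap.toContinuousLinearMap (Matrix.transposeLinearEquiv ι ι ℝ ℝ).toLinearMap

lemma hasDerivWithinAt_form {F : ℝ → Matrix ι ι ℝ} {F' : Matrix ι ι ℝ} {s : Set ℝ} {t : ℝ}
    (h : HasDerivWithinAt F F' s t) (x y : ι → ℝ) :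
    HasDerivWithinAt (fun t => x ⬝ᵥ F t *ᵥ y) (x ⬝ᵥ F' *ᵥ y) s t :=
  (formCLM x y).hasFDerivAt.comp_hasDerivWithinAt t h

lemma hasDerivWithinAt_transpose {F : ℝ → Matrix ι ι ℝ} {F' : Matrix ι ι ℝ} {s : Set ℝ} {t : ℝ}
    (h : HasDerivWithinAt F F' s t) : HasDerivWithinAt (fun t => (F t)ᵀ) F'ᵀ s t :=
  (transposeCLM (ι := ι)).hasFDerivAt.comp_hasDerivWithinAt t h

lemma hasDerivAt_exp_smul (M : Matrix ι ι ℝ) (t : ℝ) :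
    HasDerivAt (fun u : ℝ => NormedSpace.exp (u • M)) (NormedSpace.exp (t • M) * M) t :=
  hasDerivAt_exp_smul_const M t

lemma hasDerivAt_exp_smul' (M : Matrix ι ι ℝ) (t : ℝ) :
    HasDerivAt (fun u : ℝ => NormedSpace.exp (u • M)) (M * NormedSpace.exp (t • M)) t :=
  hasDerivAt_exp_smul_const' M t

lemma exp_smul_mul_exp_neg_smul (M : Matrix ι ι ℝ) (t : ℝ) :
    NormedSpace.exp (t • M) * NormedSpace.exp ((-t) • M) = 1 := by
  rw [← Matrix.exp_add_of_commute _ _ (by rw [neg_smul]; exact (Commute.refl _).neg_right)]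
  simp

lemma exp_smul_transpose (M : Matrix ι ι ℝ) (t : ℝ) :
    NormedSpace.exp (t • Mᵀ) = (NormedSpace.exp (t • M))ᵀ := by
  rw [← Matrix.transpose_smul, Matrix.exp_transpose]

end Forms

section Monotonicity

lemma monotoneOn_Ici_of_hasDerivWithinAt {f f' : ℝ → ℝ}
    (h : ∀ t, 0 ≤ t → HasDerivWithinAt f (f' t) (Ici 0) t) (h' : ∀ t, 0 ≤ t → 0 ≤ f' t) :
    MonotoneOn f (Ici 0) := by
  refine monotoneOn_of_hasDerivWithinAt_nonneg (f' := f') (convex_Ici 0)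
    (fun t ht => (h t ht).continuousWithinAt) (fun t ht => ?_) (fun t ht => ?_)
  · exact (h t (interior_subset ht)).mono interior_subset
  · exact h' t (interior_subset ht)

lemma strictMonoOn_Ici_of_hasDerivWithinAt {f f' : ℝ → ℝ}
    (h : ∀ t, 0 ≤ t → HasDerivWithinAt f (f' t) (Ici 0) t) (h' : ∀ t, 0 ≤ t → 0 < f' t) :
    StrictMonoOn f (Ici 0) := by
  refine strictMonoOn_of_hasDerivWithinAt_pos (f' := f') (convex_Ici 0)
    (fun t ht => (h t ht).continuousWithinAt) (fun t ht => ?_) (fun t ht => ?_)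
  · exact (h t (interior_subset ht)).mono interior_subset
  · exact h' t (interior_subset ht)

/-- Uniqueness for linear differential equations, in the form: a function which vanishes at `0` and
whose derivative is dominated by a locally bounded multiple of itself is zero. -/
lemma eq_zero_of_norm_deriv_le {E : Type*} [NormedAddCommGroup E] [NormedSpace ℝ E]
    {Y Y' : ℝ → E} {b : ℝ → ℝ} (hb : ContinuousOn b (Ici 0))
    (hY : ∀ t, 0 ≤ t → HasDerivWithinAt Y (Y' t) (Ici 0) t)
    (hle : ∀ t, 0 ≤ t → ‖Y' t‖ ≤ b t * ‖Y t‖) (h0 : Y 0 = 0) {t : ℝ} (ht : 0 ≤ t) : Y t = 0 := by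
  obtain ⟨K, hK⟩ := isCompact_Icc.bddAbove_image (hb.mono (Icc_subset_Ici_self : Icc 0 t ⊆ _))
  have key := norm_le_gronwallBound_of_norm_deriv_right_le (f := Y) (f' := Y') (δ := 0) (K := K)
    (ε := 0) (a := 0) (b := t)
    (fun s hs => ((hY s hs.1).continuousWithinAt).mono Icc_subset_Ici_self)
    (fun s hs => (hY s hs.1).mono (Ici_subset_Ici.2 hs.1)) (by simp [h0])
    (fun s hs => by
      rw [add_zero]
      exact (hle s hs.1).trans (mul_le_mul_of_nonneg_right
        (hK (mem_image_of_mem _ (Ico_subset_Icc_self hs))) (norm_nonneg _)))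
    t (right_mem_Icc.2 ht)
  simpa [gronwallBound_ε0_δ0] using key

end Monotonicity

/-! ### Riccati flows, their differences and their transition matrices -/

section Flows

variable {n : ℕ} {A R S : Matrix (Fin n) (Fin n) ℝ} {P Q : ℝ → Matrix (Fin n) (Fin n) ℝ}

lemma IsRiccatiFlow.continuousOn (hP : IsRiccatiFlow A R S P) : ContinuousOn P (Ici 0) :=
  fun t ht => (hP.hasDerivWithinAt t ht).continuousWithinAt

lemma IsSteadyState.isRiccatiFlow {P : Matrix (Fin n) (Fin n) ℝ} (hP : IsSteadyState A R S P) :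
    IsRiccatiFlow A R S fun _ => P :=
  ⟨hP.1, fun t _ => by
    rw [hP.2]
    exact hasDerivWithinAt_const t _ P⟩

lemma IsRiccatiFlow.transpose (hR : Rᵀ = R) (hS : Sᵀ = S) (hP : IsRiccatiFlow A R S P) :
    IsRiccatiFlow A R S fun t => (P t)ᵀ := by
  refine ⟨hP.posSemidef_zero.transpose, fun t ht => ?_⟩
  convert hasDerivWithinAt_transpose (hP.hasDerivWithinAt t ht) using 1
  simp only [ricc, Matrix.transpose_add, Matrix.transpose_sub, Matrix.transpose_mul,
    Matrix.transpose_transpose, hR, hS, Matrix.mul_assoc]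
  abel

lemma ricc_sub_ricc (P Q : Matrix (Fin n) (Fin n) ℝ) :
    ricc A R S P - ricc A R S Q = (A - P * S) * (P - Q) + (P - Q) * (Aᵀ - S * Q) := by
  simp only [ricc]
  noncomm_ring

lemma IsRiccatiFlow.hasDerivWithinAt_sub (hP : IsRiccatiFlow A R S P)
    (hQ : IsRiccatiFlow A R S Q) {t : ℝ} (ht : 0 ≤ t) :
    HasDerivWithinAt (fun t => P t - Q t)
      ((A - P t * S) * (P t - Q t) + (P t - Q t) * (Aᵀ - S * Q t)) (Ici 0) t := by
  rw [← ricc_sub_ricc (R := R)]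
  exact (hP.hasDerivWithinAt t ht).sub (hQ.hasDerivWithinAt t ht)

/-- Solutions of the Sylvester type equation `Y' = L Y + Y N` are determined by `Y 0`. -/
lemma eq_of_sylvester_ode {L N Y Z : ℝ → Matrix (Fin n) (Fin n) ℝ}
    (hL : ContinuousOn L (Ici 0)) (hN : ContinuousOn N (Ici 0))
    (hY : ∀ t, 0 ≤ t → HasDerivWithinAt Y (L t * Y t + Y t * N t) (Ici 0) t)
    (hZ : ∀ t, 0 ≤ t → HasDerivWithinAt Z (L t * Z t + Z t * N t) (Ici 0) t)
    (h0 : Y 0 = Z 0) {t : ℝ} (ht : 0 ≤ t) : Y t = Z t := by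
  rw [← sub_eq_zero]
  refine eq_zero_of_norm_deriv_le (Y := fun t => Y t - Z t) (b := fun t => ‖L t‖ + ‖N t‖)
    (hL.norm.add hN.norm) (fun s hs => (hY s hs).sub (hZ s hs)) (fun s _ => ?_) (by simp [h0]) ht
  have : L s * Y s + Y s * N s - (L s * Z s + Z s * N s)
      = L s * (Y s - Z s) + (Y s - Z s) * N s := by noncomm_ring
  rw [this]
  refine (norm_add_le _ _).trans ?_
  have h1 := norm_mul_le (L s) (Y s - Z s)
  have h2 := norm_mul_le (Y s - Z s) (N s)
  linarith

lemma IsRiccatiFlow.continuousOn_left (hP : IsRiccatiFlow A R S P) :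
    ContinuousOn (fun t => A - P t * S) (Ici 0) :=
  continuousOn_const.sub (hP.continuousOn.mul continuousOn_const)

lemma IsRiccatiFlow.continuousOn_right (hP : IsRiccatiFlow A R S P) :
    ContinuousOn (fun t => Aᵀ - S * P t) (Ici 0) :=
  continuousOn_const.sub (continuousOn_const.mul hP.continuousOn)

lemma IsRiccatiFlow.unique (hP : IsRiccatiFlow A R S P) (hQ : IsRiccatiFlow A R S Q)
    (h0 : P 0 = Q 0) {t : ℝ} (ht : 0 ≤ t) : P t = Q t := by
  rw [← sub_eq_zero]
  refine eq_of_sylvester_ode (Y := fun t => P t - Q t) (Z := fun _ => 0) hP.continuousOn_left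
    hQ.continuousOn_right (fun s hs => hP.hasDerivWithinAt_sub hQ hs) (fun s hs => ?_)
    (by simp [h0]) ht
  simpa using hasDerivWithinAt_const s (Ici 0) (0 : Matrix (Fin n) (Fin n) ℝ)

lemma IsRiccatiFlow.transpose_eq (hR : Rᵀ = R) (hS : Sᵀ = S) (hP : IsRiccatiFlow A R S P)
    {t : ℝ} (ht : 0 ≤ t) : (P t)ᵀ = P t :=
  (hP.transpose hR hS).unique hP
    (by simpa using (posSemidef_iff_real.1 hP.posSemidef_zero).1) ht

/-- The transition matrix `E` of the linear equation `x' = (A - P S) x` started at time `0`. -/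
structure IsTransitionMatrix (A S : Matrix (Fin n) (Fin n) ℝ)
    (P E : ℝ → Matrix (Fin n) (Fin n) ℝ) : Prop where
  zero : E 0 = 1
  hasDerivWithinAt : ∀ t : ℝ, 0 ≤ t → HasDerivWithinAt E ((A - P t * S) * E t) (Ici 0) t

lemma IsTransitionMatrix.continuousOn {E : ℝ → Matrix (Fin n) (Fin n) ℝ}
    (hE : IsTransitionMatrix A S P E) : ContinuousOn E (Ici 0) :=
  fun t ht => (hE.hasDerivWithinAt t ht).continuousWithinAt

/-- The upper left block of a block matrix, as a continuous linear map. -/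
noncomputable def upperLeftCLM :
    Matrix (Fin n ⊕ Fin n) (Fin n ⊕ Fin n) ℝ →L[ℝ] Matrix (Fin n) (Fin n) ℝ :=
  LinearMap.toContinuousLinearMap
    { toFun := Matrix.toBlocks₁₁, map_add' := fun _ _ => rfl, map_smul' := fun _ _ => rfl }

/-- The lower left block of a block matrix, as a continuous linear map. -/
noncomputable def lowerLeftCLM :
    Matrix (Fin n ⊕ Fin n) (Fin n ⊕ Fin n) ℝ →L[ℝ] Matrix (Fin n) (Fin n) ℝ :=
  LinearMap.toContinuousLinearMap
    { toFun := Matrix.toBlocks₂₁, map_add' := fun _ _ => rfl, map_smul' := fun _ _ => rfl }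

/-- The embedding of a matrix as the lower left block of a block matrix. -/
noncomputable def lowerLeftEmb :
    Matrix (Fin n) (Fin n) ℝ →L[ℝ] Matrix (Fin n ⊕ Fin n) (Fin n ⊕ Fin n) ℝ :=
  LinearMap.toContinuousLinearMap
    { toFun := fun B => Matrix.fromBlocks 0 0 B 0
      map_add' := fun B D => by simp [Matrix.fromBlocks_add]
      map_smul' := fun c B => by simp [Matrix.fromBlocks_smul] }

/-- The linear equation `x' = (A - P S) x` along a symmetric Riccati flow has a transition matrix
`E`, whose inverse transpose is the transition matrix `X` of the adjoint equation. Both are blocks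
of products of exponentials of the Hamiltonian matrix `[-A', S; R, A]`, because the graph of `P t`
is the image of the graph of `P 0` under the Hamiltonian flow. -/
lemma IsRiccatiFlow.exists_isTransitionMatrix (hR : Rᵀ = R) (hS : Sᵀ = S)
    (hP : IsRiccatiFlow A R S P) :
    ∃ E X : ℝ → Matrix (Fin n) (Fin n) ℝ, IsTransitionMatrix A S P E ∧ X 0 = 1 ∧
      (∀ t, 0 ≤ t → HasDerivWithinAt X (-((A - P t * S)ᵀ * X t)) (Ici 0) t) ∧
      ∀ t, 0 ≤ t → X t * (E t)ᵀ = 1 := by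
  set H : Matrix (Fin n ⊕ Fin n) (Fin n ⊕ Fin n) ℝ := Matrix.fromBlocks (-Aᵀ) S R A with hH
  -- `F t` is the graph of `P t` pulled back to time `0`
  set F : ℝ → Matrix (Fin n ⊕ Fin n) (Fin n ⊕ Fin n) ℝ := fun t =>
    NormedSpace.exp (t • -H) * Matrix.fromBlocks 1 0 (P t) 0 with hF
  set G : ℝ → Matrix (Fin n ⊕ Fin n) (Fin n ⊕ Fin n) ℝ := fun t =>
    NormedSpace.exp (t • H) * Matrix.fromBlocks 1 0 (P 0) 0 with hG
  have hF' : ∀ t, 0 ≤ t → HasDerivWithinAt F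
      (F t * Matrix.fromBlocks (Aᵀ - S * P t) 0 0 0) (Ici 0) t := by
    intro t ht
    have h1 : HasDerivWithinAt (fun t => Matrix.fromBlocks 1 0 (P t) 0 :
        ℝ → Matrix (Fin n ⊕ Fin n) (Fin n ⊕ Fin n) ℝ)
        (Matrix.fromBlocks 0 0 (ricc A R S (P t)) 0) (Ici 0) t := by
      have h2 := (lowerLeftEmb (n := n)).hasFDerivAt.comp_hasDerivWithinAt t
        (hP.hasDerivWithinAt t ht)
      have h3 := h2.const_add (Matrix.fromBlocks 1 0 0 0 :
        Matrix (Fin n ⊕ Fin n) (Fin n ⊕ Fin n) ℝ)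
      refine h3.congr_of_mem (fun s _ => ?_) ht
      change _ = _ + Matrix.fromBlocks 0 0 (P s) 0
      simp [Matrix.fromBlocks_add]
    refine ((hasDerivAt_exp_smul (-H) t).hasDerivWithinAt.fun_mul h1).congr_deriv ?_
    symm
    simp only [hF, Matrix.mul_assoc]
    rw [← Matrix.mul_add]
    congr 1
    rw [hH, Matrix.fromBlocks_neg, Matrix.fromBlocks_multiply, Matrix.fromBlocks_multiply,
      Matrix.fromBlocks_add]
    congr 1
    · simp
      abel
    · simp
    · simp only [ricc]
      noncomm_ring
    · simp
  have hG' : ∀ t, HasDerivAt G (H * G t) t := by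
    intro t
    have := (hasDerivAt_exp_smul' H t).mul_const
      (Matrix.fromBlocks 1 0 (P 0) 0 : Matrix (Fin n ⊕ Fin n) (Fin n ⊕ Fin n) ℝ)
    rwa [Matrix.mul_assoc] at this
  have hmul : ∀ (D : Matrix (Fin n ⊕ Fin n) (Fin n ⊕ Fin n) ℝ) (B : Matrix (Fin n) (Fin n) ℝ),
      D * Matrix.fromBlocks B 0 0 0
        = Matrix.fromBlocks (D.toBlocks₁₁ * B) 0 (D.toBlocks₂₁ * B) 0 := by
    intro D B
    conv_lhs => rw [← Matrix.fromBlocks_toBlocks D, Matrix.fromBlocks_multiply]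
    simp
  set U : ℝ → Matrix (Fin n) (Fin n) ℝ := fun t => (F t).toBlocks₁₁ with hU
  set V : ℝ → Matrix (Fin n) (Fin n) ℝ := fun t => (F t).toBlocks₂₁ with hV
  have hU' : ∀ t, 0 ≤ t → HasDerivWithinAt U (U t * (Aᵀ - S * P t)) (Ici 0) t := by
    intro t ht
    have := (upperLeftCLM (n := n)).hasFDerivAt.comp_hasDerivWithinAt t (hF' t ht)
    rw [hmul] at this
    exact this
  have hV' : ∀ t, 0 ≤ t → HasDerivWithinAt V (V t * (Aᵀ - S * P t)) (Ici 0) t := by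
    intro t ht
    have := (lowerLeftCLM (n := n)).hasFDerivAt.comp_hasDerivWithinAt t (hF' t ht)
    rw [hmul] at this
    exact this
  have hF0 : F 0 = Matrix.fromBlocks 1 0 (P 0) 0 := by simp [hF]
  have hVU : ∀ t, 0 ≤ t → V t = P 0 * U t := by
    intro t ht
    refine eq_of_sylvester_ode (L := fun _ => 0) (Z := fun t => P 0 * U t) continuousOn_const
      hP.continuousOn_right (fun s hs => ?_) (fun s hs => ?_) ?_ ht
    · simpa using hV' s hs
    · have := (hU' s hs).const_mul (P 0)
      simpa [Matrix.mul_assoc] using this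
    · simp [hV, hU, hF0]
  have hF12 : ∀ t, (F t) = Matrix.fromBlocks (U t) 0 (V t) 0 := by
    intro t
    have h1 : F t = F t * Matrix.fromBlocks 1 0 0 0 := by
      simp only [hF, Matrix.mul_assoc]
      simp [Matrix.fromBlocks_multiply]
    rw [h1, hmul]
    simp [hU, hV]
  have hGU : ∀ t, 0 ≤ t → G t * Matrix.fromBlocks (U t) 0 0 0
      = Matrix.fromBlocks 1 0 (P t) 0 := by
    intro t ht
    have h1 : Matrix.fromBlocks 1 0 (P 0) 0 * Matrix.fromBlocks (U t) 0 0 0 = F t := by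
      rw [hF12, hVU t ht]
      simp [Matrix.fromBlocks_multiply]
    simp only [hG]
    rw [Matrix.mul_assoc, h1]
    simp only [hF]
    rw [← Matrix.mul_assoc, smul_neg, ← neg_smul, exp_smul_mul_exp_neg_smul, Matrix.one_mul]
  have hXU : ∀ t, 0 ≤ t → (G t).toBlocks₁₁ * U t = 1 ∧ (G t).toBlocks₂₁ * U t = P t := by
    intro t ht
    have h1 := hGU t ht
    rw [hmul, Matrix.fromBlocks_inj] at h1
    exact ⟨h1.1, h1.2.2.1⟩
  refine ⟨fun t => (U t)ᵀ, fun t => (G t).toBlocks₁₁, ⟨?_, fun t ht => ?_⟩, ?_, fun t ht => ?_,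
    fun t ht => ?_⟩
  · simp [hU, hF0]
  · convert hasDerivWithinAt_transpose (hU' t ht) using 1
    simp [Matrix.transpose_mul, hS, hP.transpose_eq hR hS ht]
  · simp [hG]
  · have h1 := (upperLeftCLM (n := n)).hasFDerivAt.comp_hasDerivWithinAt t
      (hG' t).hasDerivWithinAt (s := Ici 0)
    have h2 : (G t).toBlocks₂₁ = P t * (G t).toBlocks₁₁ := by
      obtain ⟨h3, h4⟩ := hXU t ht
      rw [← h4, Matrix.mul_assoc, mul_eq_one_comm.1 h3, Matrix.mul_one]
    have h5 : (H * G t).toBlocks₁₁ = -((A - P t * S)ᵀ * (G t).toBlocks₁₁) := by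
      conv_lhs => rw [← Matrix.fromBlocks_toBlocks (G t), hH, Matrix.fromBlocks_multiply]
      rw [Matrix.toBlocks_fromBlocks₁₁, h2, Matrix.transpose_sub, Matrix.transpose_mul, hS,
        hP.transpose_eq hR hS ht]
      noncomm_ring
    rw [← h5]
    exact h1
  · simpa using (hXU t ht).1

/-- The difference of two Riccati flows is transported by their transition matrices. -/
lemma IsRiccatiFlow.sub_eq {E F : ℝ → Matrix (Fin n) (Fin n) ℝ} (hR : Rᵀ = R) (hS : Sᵀ = S)
    (hP : IsRiccatiFlow A R S P) (hQ : IsRiccatiFlow A R S Q) (hE : IsTransitionMatrix A S P E)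
    (hF : IsTransitionMatrix A S Q F) {t : ℝ} (ht : 0 ≤ t) :
    P t - Q t = E t * (P 0 - Q 0) * (F t)ᵀ := by
  refine eq_of_sylvester_ode (Y := fun t => P t - Q t)
    (Z := fun t => E t * (P 0 - Q 0) * (F t)ᵀ) hP.continuousOn_left
    hQ.continuousOn_right (fun s hs => hP.hasDerivWithinAt_sub hQ hs) (fun s hs => ?_)
    (by simp [hE.zero, hF.zero]) ht
  refine (((hE.hasDerivWithinAt s hs).mul_const (P 0 - Q 0)).fun_mul
    (hasDerivWithinAt_transpose (hF.hasDerivWithinAt s hs))).congr_deriv ?_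
  simp only [Matrix.transpose_mul, Matrix.transpose_sub, hS, hQ.transpose_eq hR hS hs,
    Matrix.mul_assoc]

lemma IsRiccatiFlow.norm_sub_le {E F : ℝ → Matrix (Fin n) (Fin n) ℝ} (hR : Rᵀ = R) (hS : Sᵀ = S)
    (hP : IsRiccatiFlow A R S P) (hQ : IsRiccatiFlow A R S Q) (hE : IsTransitionMatrix A S P E)
    (hF : IsTransitionMatrix A S Q F) {t : ℝ} (ht : 0 ≤ t) :
    ‖P t - Q t‖ ≤ ‖E t‖ * ‖F t‖ * ‖P 0 - Q 0‖ := by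
  rw [hP.sub_eq hR hS hQ hE hF ht]
  calc _ ≤ ‖E t‖ * ‖P 0 - Q 0‖ * ‖(F t)ᵀ‖ := norm_mul₃_le
    _ = _ := by rw [l2_opNorm_transpose]; ring

lemma isTransitionMatrix_exp (P : Matrix (Fin n) (Fin n) ℝ) :
    IsTransitionMatrix A S (fun _ => P) fun t => NormedSpace.exp (t • (A - P * S)) :=
  ⟨by simp, fun t _ => (hasDerivAt_exp_smul' _ t).hasDerivWithinAt⟩

end Flows

/-! ### Grönwall estimate for perturbed semigroups -/

/-- The integral form of Grönwall's lemma for the integrable weight `s ↦ a exp (-γ s)`. -/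
lemma le_mul_exp_of_le_integral {g : ℝ → ℝ} {k a γ : ℝ} (hg : ContinuousOn g (Ici 0))
    (ha : 0 ≤ a) (hγ : 0 < γ)
    (hg0 : ∀ t, 0 ≤ t → 0 ≤ g t)
    (h : ∀ t, 0 ≤ t → g t ≤ k + ∫ s in (0 : ℝ)..t, a * Real.exp (-(γ * s)) * g s)
    {t : ℝ} (ht : 0 ≤ t) : g t ≤ k * Real.exp (a / γ) := by
  -- a continuous extension of `g` to the real line makes its primitive differentiable everywhere
  set f : ℝ → ℝ := fun s => a * Real.exp (-(γ * s)) * g (max s 0) with hf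
  have hgc : Continuous fun s => g (max s 0) :=
    hg.comp_continuous (continuous_id.max continuous_const) fun s => mem_Ici.2 (le_max_right _ _)
  have hfc : Continuous f := Continuous.mul (by fun_prop) hgc
  have hfg : ∀ t, 0 ≤ t → ∫ s in (0 : ℝ)..t, a * Real.exp (-(γ * s)) * g s
      = ∫ s in (0 : ℝ)..t, f s := by
    intro t ht
    refine intervalIntegral.integral_congr fun s hs => ?_
    rw [uIcc_of_le ht] at hs
    simp only [hf, max_eq_left hs.1]
  set G : ℝ → ℝ := fun t => k + ∫ s in (0 : ℝ)..t, f s with hG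
  have hG' : ∀ t, HasDerivAt G (f t) t := fun t =>
    (hfc.integral_hasStrictDerivAt 0 t).hasDerivAt.const_add k
  have hgG : ∀ t, 0 ≤ t → g t ≤ G t := fun t ht => by
    have := h t ht
    rwa [hfg t ht] at this
  -- the weight `exp (a / γ * exp (-γ t))` is an integrating factor
  set w : ℝ → ℝ := fun t => Real.exp (a / γ * Real.exp (-(γ * t))) with hw
  have hw' : ∀ t, HasDerivAt w (w t * (-(a * Real.exp (-(γ * t))))) t := by
    intro t
    have h1 : HasDerivAt (fun t : ℝ => -(γ * t)) (-γ) t := by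
      simpa using (hasDerivAt_id t).const_mul (-γ)
    have h2 := ((h1.exp).const_mul (a / γ)).exp
    convert h2 using 1
    simp only [hw]
    field_simp
  have hmono : MonotoneOn (fun t => -(G t * w t)) (Ici 0) := by
    refine monotoneOn_Ici_of_hasDerivWithinAt
      (f' := fun t => -(f t * w t + G t * (w t * (-(a * Real.exp (-(γ * t)))))))
      (fun t _ => ((hG' t).mul (hw' t)).neg.hasDerivWithinAt) fun t ht => ?_
    have h1 : f t = a * Real.exp (-(γ * t)) * g t := by simp only [hf, max_eq_left ht]
    have h2 : 0 ≤ w t := (Real.exp_pos _).le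
    have h3 : 0 ≤ a * Real.exp (-(γ * t)) := by positivity
    have h4 := mul_nonneg (mul_nonneg h3 h2) (sub_nonneg.2 (hgG t ht))
    simp only [h1]
    linarith
  have h1 := hmono (mem_Ici.2 le_rfl) ht ht
  have h2 : G 0 * w 0 = k * Real.exp (a / γ) := by simp [hG, hw]
  have h3 : 1 ≤ w t := Real.one_le_exp (by positivity)
  have h4 : 0 ≤ G t := (hg0 t ht).trans (hgG t ht)
  have h5 := le_mul_of_one_le_right h4 h3
  have h6 := hgG t ht
  simp only at h1
  linarith

/-- If `‖exp (t M)‖ ≤ k exp (l t)` then an integrable perturbation of `M` keeps the rate `l` and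
multiplies the constant by `exp (k ∫ ‖perturbation‖)`. -/
lemma norm_le_of_perturbed_ode {n : ℕ} {M : Matrix (Fin n) (Fin n) ℝ}
    {B E : ℝ → Matrix (Fin n) (Fin n) ℝ} {k l c γ : ℝ}
    (hM : ∀ t : ℝ, 0 ≤ t → ‖NormedSpace.exp (t • M)‖ ≤ k * Real.exp (l * t))
    (hBc : ContinuousOn B (Ici 0)) (hc : 0 ≤ c) (hγ : 0 < γ)
    (hB : ∀ t, 0 ≤ t → ‖B t‖ ≤ c * Real.exp (-(γ * t)))
    (hE0 : E 0 = 1) (hE : ∀ t, 0 ≤ t → HasDerivWithinAt E ((M + B t) * E t) (Ici 0) t)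
    {t : ℝ} (ht : 0 ≤ t) :
    ‖E t‖ ≤ k * Real.exp (k * c / γ) * Real.exp (l * t) := by
  have hEc : ContinuousOn E (Ici 0) := fun t ht => (hE t ht).continuousWithinAt
  have hk : 0 ≤ k := by
    have := (norm_nonneg _).trans (hM 0 le_rfl)
    simpa using this
  have hec : Continuous fun s : ℝ => NormedSpace.exp (s • M) :=
    continuous_iff_continuousAt.2 fun s => (hasDerivAt_exp_smul M s).continuousAt
  -- variation of constants
  have hvar : ∀ t, 0 ≤ t → E t = NormedSpace.exp (t • M)
      + ∫ s in (0 : ℝ)..t, NormedSpace.exp ((t - s) • M) * B s * E s := by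
    intro t ht
    have hec' : Continuous fun s : ℝ => NormedSpace.exp ((t - s) • M) :=
      hec.comp (continuous_const.sub continuous_id)
    have hsub : Icc 0 t ⊆ Ici 0 := Icc_subset_Ici_self
    have h1 : ∀ s, 0 ≤ s → HasDerivWithinAt (fun s => NormedSpace.exp ((t - s) • M) * E s)
        (NormedSpace.exp ((t - s) • M) * B s * E s) (Ici 0) s := by
      intro s hs
      have h2 : HasDerivAt (fun s : ℝ => NormedSpace.exp ((t - s) • M))
          (-(NormedSpace.exp ((t - s) • M) * M)) s := by
        have := (hasDerivAt_exp_smul M (t - s)).scomp s ((hasDerivAt_id s).const_sub t)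
        exact this.congr_deriv (by simp)
      refine (h2.hasDerivWithinAt.fun_mul (hE s hs)).congr_deriv ?_
      noncomm_ring
    have h3 := intervalIntegral.integral_eq_sub_of_hasDeriv_right_of_le ht
      (f := fun s => NormedSpace.exp ((t - s) • M) * E s)
      (f' := fun s => NormedSpace.exp ((t - s) • M) * B s * E s)
      (fun s hs => ((h1 s hs.1).continuousWithinAt).mono hsub)
      (fun s hs => (h1 s hs.1.le).mono fun r hr => hs.1.le.trans (mem_Ioi.1 hr).le)
      (ContinuousOn.intervalIntegrable (by
        rw [uIcc_of_le ht]
        exact (hec'.continuousOn.mul (hBc.mono hsub)).mul (hEc.mono hsub)))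
    rw [h3]
    simp [hE0]
  have key := le_mul_exp_of_le_integral (g := fun t => Real.exp (-(l * t)) * ‖E t‖) (k := k)
    (a := k * c) (γ := γ)
    (ContinuousOn.mul (by fun_prop) hEc.norm) (by positivity) hγ (fun t _ => by positivity)
    (fun t ht => ?_) ht
  · have h1 : ‖E t‖ = Real.exp (-(l * t)) * ‖E t‖ * Real.exp (l * t) := by
      rw [mul_right_comm, ← Real.exp_add]; simp
    rw [h1]
    exact mul_le_mul_of_nonneg_right key (Real.exp_pos _).le
  · have hsub : Icc 0 t ⊆ Ici 0 := Icc_subset_Ici_self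
    have h1 : ‖∫ s in (0 : ℝ)..t, NormedSpace.exp ((t - s) • M) * B s * E s‖
        ≤ ∫ s in (0 : ℝ)..t, k * Real.exp (l * (t - s)) * (c * Real.exp (-(γ * s))) * ‖E s‖ := by
      refine intervalIntegral.norm_integral_le_of_norm_le ht
        (MeasureTheory.ae_of_all _ fun s hs => ?_) (ContinuousOn.intervalIntegrable (by
          rw [uIcc_of_le ht]
          exact ContinuousOn.mul (by fun_prop) (hEc.mono hsub).norm))
      refine norm_mul₃_le.trans ?_
      have h2 := hM (t - s) (sub_nonneg.2 hs.2)
      have h3 := hB s hs.1.le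
      gcongr
    have h2 := norm_add_le (NormedSpace.exp (t • M))
      (∫ s in (0 : ℝ)..t, NormedSpace.exp ((t - s) • M) * B s * E s)
    rw [← hvar t ht] at h2
    have h3 : ∫ s in (0 : ℝ)..t, k * c * Real.exp (-(γ * s)) * (Real.exp (-(l * s)) * ‖E s‖)
        = Real.exp (-(l * t)) * ∫ s in (0 : ℝ)..t,
          k * Real.exp (l * (t - s)) * (c * Real.exp (-(γ * s))) * ‖E s‖ := by
      rw [← intervalIntegral.integral_const_mul]
      refine intervalIntegral.integral_congr fun s _ => ?_
      have : Real.exp (-(l * s)) = Real.exp (-(l * t)) * Real.exp (l * (t - s)) := by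
        rw [← Real.exp_add]; ring_nf
      simp only [this]
      ring
    rw [h3]
    have h4 : Real.exp (-(l * t)) * (k * Real.exp (l * t)) = k := by
      rw [mul_left_comm, ← Real.exp_add]; simp
    have h5 := mul_le_mul_of_nonneg_left (h2.trans (add_le_add (hM t ht) h1))
      (Real.exp_pos (-(l * t))).le
    rwa [mul_add, h4] at h5

/-! ### Spectral abscissa, logarithmic norm and the growth of the matrix exponential -/

section Spectrum

variable {n : ℕ}

lemma exists_eigenvector_of_mem_spectrum {ι : Type*} [Fintype ι] [DecidableEq ι]
    {M : Matrix ι ι ℂ} {z : ℂ} (hz : z ∈ spectrum ℂ M) : ∃ v : ι → ℂ, v ≠ 0 ∧ M *ᵥ v = z • v := by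
  rw [← Matrix.spectrum_toLin', ← Module.End.hasEigenvalue_iff_mem_spectrum] at hz
  obtain ⟨v, hv⟩ := hz.exists_hasEigenvector
  exact ⟨v, hv.2, by simpa using hv.apply_eq_smul⟩

lemma mem_spectrum_of_eigenvector {ι : Type*} [Fintype ι] [DecidableEq ι]
    {M : Matrix ι ι ℂ} {z : ℂ} {v : ι → ℂ} (hv : v ≠ 0) (h : M *ᵥ v = z • v) :
    z ∈ spectrum ℂ M := by
  rw [← Matrix.spectrum_toLin', ← Module.End.hasEigenvalue_iff_mem_spectrum]
  exact Module.End.hasEigenvalue_of_hasEigenvector (x := v)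
    ⟨Module.End.mem_eigenspace_iff.2 (by simpa using h), hv⟩

/-- An eigenvalue `z` of a real matrix has a pair of real vectors (the real and imaginary parts of
an eigenvector) on which the matrix acts as multiplication by `z`. -/
lemma exists_real_eigenpair {M : Matrix (Fin n) (Fin n) ℝ} {z : ℂ}
    (hz : z ∈ spectrum ℂ (M.map (fun x : ℝ => (x : ℂ)))) :
    ∃ x y : Fin n → ℝ, (x ≠ 0 ∨ y ≠ 0) ∧ M *ᵥ x = z.re • x - z.im • y ∧
      M *ᵥ y = z.im • x + z.re • y := by
  obtain ⟨v, hv, h⟩ := exists_eigenvector_of_mem_spectrum hz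
  refine ⟨fun i => (v i).re, fun i => (v i).im, ?_, ?_, ?_⟩
  · by_contra! hc
    exact hv (funext fun i => Complex.ext (congrFun hc.1 i) (congrFun hc.2 i))
  · ext i
    have := congrArg Complex.re (congrFun h i)
    simpa [Matrix.mulVec, dotProduct] using this
  · ext i
    have := congrArg Complex.im (congrFun h i)
    simp [Matrix.mulVec, dotProduct] at this ⊢
    linarith

lemma spectrum_map_transpose (M : Matrix (Fin n) (Fin n) ℝ) :
    spectrum ℂ (Mᵀ.map (fun x : ℝ => (x : ℂ))) = spectrum ℂ (M.map (fun x : ℝ => (x : ℂ))) := by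
  ext z
  rw [spectrum.mem_iff, spectrum.mem_iff, ← Matrix.isUnit_transpose, Matrix.transpose_sub,
    Matrix.transpose_map, Matrix.transpose_transpose, Matrix.algebraMap_eq_diagonal,
    Matrix.diagonal_transpose]

lemma exp_mulVec_of_eigenvector {ι : Type*} [Fintype ι] [DecidableEq ι]
    {M : Matrix ι ι ℂ} {z : ℂ} {v : ι → ℂ} (h : M *ᵥ v = z • v) :
    NormedSpace.exp M *ᵥ v = Complex.exp z • v := by
  have hpow : ∀ k : ℕ, (M ^ k) *ᵥ v = z ^ k • v := by
    intro k
    induction k with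
    | zero => simp
    | succ k ih => rw [pow_succ, ← Matrix.mulVec_mulVec, h, Matrix.mulVec_smul, ih, smul_smul,
        pow_succ, mul_comm]
  let L : Matrix ι ι ℂ →ₗ[ℂ] (ι → ℂ) :=
    { toFun := fun B => B *ᵥ v
      map_add' := fun B D => Matrix.add_mulVec B D v
      map_smul' := fun c B => Matrix.smul_mulVec c B v }
  have h1 := (NormedSpace.exp_series_hasSum_exp' (𝕂 := ℂ) M).mapL
    (LinearMap.toContinuousLinearMap L)
  have h2 := (NormedSpace.exp_series_hasSum_exp' (𝕂 := ℂ) z).smul_const v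
  rw [← Complex.exp_eq_exp_ℂ] at h2
  refine HasSum.unique h1 (h2.congr_fun fun k => ?_)
  change ((_ : ℂ) • M ^ k) *ᵥ v = _
  rw [Matrix.smul_mulVec, hpow, smul_smul, smul_eq_mul]

/-- Spectral mapping for the matrix exponential: an eigenspace of `exp M` is stable under `M`, hence
contains an eigenvector of `M`. -/
lemma exists_exp_eq_of_mem_spectrum_exp {ι : Type*} [Fintype ι] [DecidableEq ι]
    {M : Matrix ι ι ℂ} {w : ℂ} (hw : w ∈ spectrum ℂ (NormedSpace.exp M)) :
    ∃ z ∈ spectrum ℂ M, Complex.exp z = w := by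
  rw [← Matrix.spectrum_toLin', ← Module.End.hasEigenvalue_iff_mem_spectrum] at hw
  set f : Module.End ℂ (ι → ℂ) := Matrix.toLin' M
  set g : Module.End ℂ (ι → ℂ) := Matrix.toLin' (NormedSpace.exp M)
  have hcomm : Commute g f := by
    have h : Commute (NormedSpace.exp M) M := ((Commute.refl M).exp_left)
    simp only [Commute, SemiconjBy, f, g, Module.End.mul_eq_comp]
    rw [← Matrix.toLin'_mul, ← Matrix.toLin'_mul, h.eq]
  have hmaps : ∀ x ∈ Module.End.eigenspace g w, f x ∈ Module.End.eigenspace g w := by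
    intro x hx
    rw [Module.End.mem_eigenspace_iff] at hx ⊢
    have : g (f x) = f (g x) := LinearMap.congr_fun hcomm.eq x
    rw [this, hx, map_smul]
  have : Nontrivial (Module.End.eigenspace g w) :=
    (Submodule.nontrivial_iff_ne_bot).2 hw
  obtain ⟨z, hz⟩ := Module.End.exists_eigenvalue (f.restrict hmaps)
  obtain ⟨v, hv⟩ := hz.exists_hasEigenvector
  have hv0 : (v : ι → ℂ) ≠ 0 := fun h => hv.2 (Subtype.ext h)
  have hMv : M *ᵥ (v : ι → ℂ) = z • (v : ι → ℂ) := by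
    have := congrArg Subtype.val hv.apply_eq_smul
    simpa [f] using this
  refine ⟨z, mem_spectrum_of_eigenvector hv0 hMv, ?_⟩
  have h1 := exp_mulVec_of_eigenvector hMv
  have h2 : NormedSpace.exp M *ᵥ (v : ι → ℂ) = w • (v : ι → ℂ) := by
    have := Module.End.mem_eigenspace_iff.1 v.2
    simpa [g] using this
  exact smul_left_injective ℂ hv0 (h1.symm.trans h2)

lemma l2_opNorm_le_norm_map (B : Matrix (Fin n) (Fin n) ℝ) :
    ‖B‖ ≤ ‖B.map (fun x : ℝ => (x : ℂ))‖ := by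
  have hnorm : ∀ x : Fin n → ℝ, ‖WithLp.toLp 2 fun i => (x i : ℂ)‖ = ‖WithLp.toLp 2 x‖ := by
    intro x
    simp [EuclideanSpace.norm_eq]
  refine l2_opNorm_le_of_forall_norm_toLp (norm_nonneg _) fun x => ?_
  rw [← hnorm, ← hnorm]
  have h := Matrix.l2_opNorm_mulVec (B.map (fun x : ℝ => (x : ℂ)))
    (WithLp.toLp 2 fun i => (x i : ℂ))
  convert h using 2
  ext i
  simp [Matrix.mulVec, dotProduct]

lemma map_exp_ofReal (M : Matrix (Fin n) (Fin n) ℝ) :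
    (NormedSpace.exp M).map (fun x : ℝ => (x : ℂ))
      = NormedSpace.exp (M.map (fun x : ℝ => (x : ℂ))) := by
  let _ : NormedAlgebra ℚ (Matrix (Fin n) (Fin n) ℝ) := .restrictScalars ℚ ℝ _
  exact NormedSpace.map_exp (Complex.ofRealHom.mapMatrix (m := Fin n))
    (continuous_id.matrix_map Complex.continuous_ofReal) M

/-- A bound strictly above the real parts of the eigenvalues of `M` is an exponential growth rate
of the semigroup `exp (t M)`: Gelfand's formula for `exp M` gives the bound at integer times. -/
lemma exists_norm_exp_le (hn : 0 < n) {M : Matrix (Fin n) (Fin n) ℝ} {c : ℝ}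
    (h : ∀ z ∈ spectrum ℂ (M.map (fun x : ℝ => (x : ℂ))), z.re < c) :
    ∃ K : ℝ, ∀ t : ℝ, 0 ≤ t → ‖NormedSpace.exp (t • M)‖ ≤ K * Real.exp (c * t) := by
  have : Nonempty (Fin n) := ⟨⟨0, hn⟩⟩
  set b := NormedSpace.exp (M.map (fun x : ℝ => (x : ℂ))) with hb
  have hrad : spectralRadius ℂ b < ((Real.exp c).toNNReal : ENNReal) := by
    refine spectrum.spectralRadius_lt_of_forall_lt b fun w hw => ?_
    obtain ⟨z, hz, rfl⟩ := exists_exp_eq_of_mem_spectrum_exp hw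
    rw [← NNReal.coe_lt_coe, Real.coe_toNNReal _ (Real.exp_pos c).le]
    simpa [Complex.norm_exp] using h z hz
  have hev : ∀ᶠ k : ℕ in atTop, ‖b ^ k‖ ≤ Real.exp c ^ k := by
    filter_upwards [(spectrum.pow_nnnorm_pow_one_div_tendsto_nhds_spectralRadius
      b).eventually_lt_const hrad, eventually_gt_atTop 0] with k hk hk0
    have hk' : (k : ℝ) ≠ 0 := by positivity
    have h1 := ENNReal.rpow_le_rpow hk.le (Nat.cast_nonneg k : (0 : ℝ) ≤ k)
    rw [← ENNReal.rpow_mul, one_div_mul_cancel hk', ENNReal.rpow_one, ENNReal.rpow_natCast] at h1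
    have h2 : ‖b ^ k‖₊ ≤ (Real.exp c).toNNReal ^ k := by exact_mod_cast h1
    rw [← NNReal.coe_le_coe, NNReal.coe_pow, Real.coe_toNNReal _ (Real.exp_pos c).le] at h2
    exact h2
  obtain ⟨N, hN⟩ := eventually_atTop.1 hev
  obtain ⟨K, hK⟩ : ∃ K : ℝ, ∀ k : ℕ, ‖b ^ k‖ ≤ K * Real.exp c ^ k := by
    refine ⟨1 + ∑ j ∈ Finset.range N, ‖b ^ j‖ / Real.exp c ^ j, fun k => ?_⟩
    have hs : 0 ≤ ∑ j ∈ Finset.range N, ‖b ^ j‖ / Real.exp c ^ j :=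
      Finset.sum_nonneg fun j _ => by positivity
    have hp : 0 < Real.exp c ^ k := by positivity
    rcases lt_or_ge k N with hk | hk
    · have h1 : ‖b ^ k‖ / Real.exp c ^ k ≤ ∑ j ∈ Finset.range N, ‖b ^ j‖ / Real.exp c ^ j :=
        Finset.single_le_sum (f := fun j => ‖b ^ j‖ / Real.exp c ^ j)
          (fun j _ => by positivity) (Finset.mem_range.2 hk)
      rw [← div_le_iff₀ hp]
      linarith
    · refine (hN k hk).trans ?_
      nlinarith
  have hKn : ∀ k : ℕ, ‖NormedSpace.exp ((k : ℝ) • M)‖ ≤ K * Real.exp c ^ k := by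
    intro k
    refine (l2_opNorm_le_norm_map _).trans ?_
    have h1 : NormedSpace.exp ((k : ℝ) • M) = NormedSpace.exp M ^ k := by
      rw [← Matrix.exp_nsmul, Nat.cast_smul_eq_nsmul]
    have h2 : (NormedSpace.exp M ^ k).map (fun x : ℝ => (x : ℂ)) = b ^ k := by
      rw [hb, ← map_exp_ofReal]
      exact map_pow (Complex.ofRealHom.mapMatrix (m := Fin n)) _ k
    rw [h1, h2]
    exact hK k
  have hK0 : 0 ≤ K := by simpa using (norm_nonneg _).trans (hK 0)
  have hec : Continuous fun s : ℝ => NormedSpace.exp (s • M) :=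
    continuous_iff_continuousAt.2 fun s => (hasDerivAt_exp_smul M s).continuousAt
  obtain ⟨D, hD⟩ := (isCompact_Icc (a := (0 : ℝ)) (b := 1)).bddAbove_image hec.norm.continuousOn
  have hD0 : 0 ≤ D := (norm_nonneg _).trans
    (hD (mem_image_of_mem _ (left_mem_Icc.2 zero_le_one)))
  refine ⟨D * (K * Real.exp |c|), fun t ht => ?_⟩
  set k := ⌊t⌋₊
  have hk1 : (k : ℝ) ≤ t := Nat.floor_le ht
  have hk2 : t < k + 1 := Nat.lt_floor_add_one t
  have hsplit : NormedSpace.exp (t • M)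
      = NormedSpace.exp ((t - k) • M) * NormedSpace.exp ((k : ℝ) • M) := by
    rw [← Matrix.exp_add_of_commute _ _
      ((Commute.refl M).smul_left _ |>.smul_right _), ← add_smul, sub_add_cancel]
  have h1 : ‖NormedSpace.exp ((t - k) • M)‖ ≤ D :=
    hD (mem_image_of_mem _ ⟨by linarith, by linarith⟩)
  have h2 : Real.exp c ^ k ≤ Real.exp |c| * Real.exp (c * t) := by
    rw [← Real.exp_nat_mul, ← Real.exp_add]
    refine Real.exp_le_exp.2 ?_
    have : -(c * (t - k)) ≤ |c| := by
      refine (neg_le_abs _).trans ?_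
      rw [abs_mul]
      refine mul_le_of_le_one_right (abs_nonneg c) ?_
      rw [abs_of_nonneg (by linarith)]
      linarith
    linarith
  rw [hsplit]
  calc _ ≤ ‖NormedSpace.exp ((t - k) • M)‖ * ‖NormedSpace.exp ((k : ℝ) • M)‖ := norm_mul_le _ _
    _ ≤ D * (K * Real.exp c ^ k) := by
        have := hKn k
        gcongr
    _ ≤ D * (K * (Real.exp |c| * Real.exp (c * t))) := by gcongr
    _ = _ := by ring

lemma re_le_spectralAbscissa {M : Matrix (Fin n) (Fin n) ℝ} {z : ℂ}
    (hz : z ∈ spectrum ℂ (M.map (fun x : ℝ => (x : ℂ)))) : z.re ≤ spectralAbscissa M :=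
  le_csSup ((spectrum.isCompact _).image Complex.continuous_re).bddAbove (mem_image_of_mem _ hz)

lemma spectralAbscissa_lt (hn : 0 < n) {M : Matrix (Fin n) (Fin n) ℝ} {c : ℝ}
    (h : ∀ z ∈ spectrum ℂ (M.map (fun x : ℝ => (x : ℂ))), z.re < c) : spectralAbscissa M < c := by
  have : Nonempty (Fin n) := ⟨⟨0, hn⟩⟩
  obtain ⟨z, hz, hz'⟩ := ((spectrum.isCompact (𝕜 := ℂ) (M.map (fun x : ℝ => (x : ℂ)))).image
    Complex.continuous_re).sSup_mem ((spectrum.nonempty _).image _)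
  rw [spectralAbscissa, ← hz']
  exact h z hz

lemma exists_isExpBound (hn : 0 < n) {M : Matrix (Fin n) (Fin n) ℝ}
    (h : spectralAbscissa M < 0) {ε : ℝ} (hε : 0 < ε) : ∃ k, IsExpBound M ε k :=
  exists_norm_exp_le hn fun _ hz => (re_le_spectralAbscissa hz).trans_lt (by nlinarith)

lemma dotProduct_mulVec_le_logNorm (M : Matrix (Fin n) (Fin n) ℝ) (x : Fin n → ℝ) :
    x ⬝ᵥ M *ᵥ x ≤ logNorm M * (x ⬝ᵥ x) := by
  rcases eq_or_ne x 0 with rfl | hx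
  · simp
  have hpos := dotProduct_self_pos hx
  rw [← div_le_iff₀ hpos]
  refine le_csInf ⟨‖M‖, fun y => ?_⟩ fun a ha => (div_le_iff₀ hpos).2 (ha x)
  have := (le_abs_self _).trans (abs_dotProduct_mulVec_le M y y)
  rwa [← norm_toLp_sq, sq]

/-- The function `exp (-2 μ(M) t) ‖exp (t M) x‖ ^ 2` is nonincreasing. -/
lemma norm_exp_le_logNorm (M : Matrix (Fin n) (Fin n) ℝ) {t : ℝ} (ht : 0 ≤ t) :
    ‖NormedSpace.exp (t • M)‖ ≤ Real.exp (logNorm M * t) := by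
  refine l2_opNorm_le_of_forall_norm_toLp (Real.exp_pos _).le fun x => ?_
  set E : ℝ → Matrix (Fin n) (Fin n) ℝ := fun t => NormedSpace.exp (t • M) with hE
  have hform : ∀ s, x ⬝ᵥ ((E s)ᵀ * E s) *ᵥ x = (E s *ᵥ x) ⬝ᵥ (E s *ᵥ x) := fun s => by
    rw [← Matrix.mulVec_mulVec, dotProduct_mulVec_transpose]
  have hmono := monotoneOn_Ici_of_hasDerivWithinAt
    (f := fun s => -(Real.exp (-(2 * logNorm M) * s) * (x ⬝ᵥ ((E s)ᵀ * E s) *ᵥ x)))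
    (f' := fun s => -(Real.exp (-(2 * logNorm M) * s) * (-(2 * logNorm M))
        * (x ⬝ᵥ ((E s)ᵀ * E s) *ᵥ x) + Real.exp (-(2 * logNorm M) * s)
        * (x ⬝ᵥ ((M * E s)ᵀ * E s + (E s)ᵀ * (M * E s)) *ᵥ x)))
    (fun s _ => by
      have h1 : HasDerivAt (fun s : ℝ => Real.exp (-(2 * logNorm M) * s))
          (Real.exp (-(2 * logNorm M) * s) * (-(2 * logNorm M))) s := by
        simpa using ((hasDerivAt_id s).const_mul (-(2 * logNorm M))).exp
      have h2 := (hasDerivAt_exp_smul' M s).hasDerivWithinAt (s := Ici 0)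
      exact (h1.hasDerivWithinAt.fun_mul
        (hasDerivWithinAt_form ((hasDerivWithinAt_transpose h2).fun_mul h2) x x)).fun_neg)
    (fun s _ => by
      have h1 : x ⬝ᵥ ((M * E s)ᵀ * E s + (E s)ᵀ * (M * E s)) *ᵥ x
          = 2 * ((E s *ᵥ x) ⬝ᵥ M *ᵥ (E s *ᵥ x)) := by
        rw [Matrix.add_mulVec, dotProduct_add, ← Matrix.mulVec_mulVec, ← Matrix.mulVec_mulVec,
          dotProduct_mulVec_transpose, dotProduct_mulVec_transpose, ← Matrix.mulVec_mulVec,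
          dotProduct_comm]
        ring
      have h2 := dotProduct_mulVec_le_logNorm M (E s *ᵥ x)
      have h3 := mul_nonneg (Real.exp_pos (-(2 * logNorm M) * s)).le (sub_nonneg.2 h2)
      rw [h1, hform]
      linarith)
  have h1 := hmono (mem_Ici.2 le_rfl) ht ht
  simp only [hform, ← norm_toLp_sq] at h1
  simp only [hE, zero_smul, NormedSpace.exp_zero, Matrix.one_mulVec, mul_zero, Real.exp_zero,
    one_mul, neg_le_neg_iff] at h1
  refine abs_le_of_sq_le_sq' ?_ (by positivity) |>.2
  rw [mul_pow, ← Real.exp_nat_mul]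
  have h2 : Real.exp (((2 : ℕ) : ℝ) * (logNorm M * t)) * Real.exp (-(2 * logNorm M) * t) = 1 := by
    rw [← Real.exp_add]
    simp
    ring
  have h3 := mul_le_mul_of_nonneg_left h1
    (Real.exp_pos (((2 : ℕ) : ℝ) * (logNorm M * t))).le
  rwa [← mul_assoc, h2, one_mul] at h3

end Spectrum

/-! ### Stable matrices and the Lyapunov equation -/

section Lyapunov

variable {n : ℕ}

/-- A real square matrix is stable if all its complex eigenvalues have negative real part. -/
def IsStable (M : Matrix (Fin n) (Fin n) ℝ) : Prop :=
  ∀ z ∈ spectrum ℂ (M.map (fun x : ℝ => (x : ℂ))), z.re < 0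

lemma IsStable.of_transpose {M : Matrix (Fin n) (Fin n) ℝ} (h : IsStable Mᵀ) : IsStable M := by
  rwa [IsStable, spectrum_map_transpose] at h

/-- Lyapunov's criterion. -/
lemma isStable_of_lyapunov {M X Q : Matrix (Fin n) (Fin n) ℝ} (hX : X.PosSemidef) (hQ : Q.PosDef)
    (h : M * X + X * Mᵀ = -Q) : IsStable M := by
  intro z hz
  rw [← spectrum_map_transpose] at hz
  obtain ⟨x, y, hxy, hx, hy⟩ := exists_real_eigenpair hz
  rw [posSemidef_iff_real] at hX
  have hform : ∀ v, 2 * ((Mᵀ *ᵥ v) ⬝ᵥ X *ᵥ v) = -(v ⬝ᵥ Q *ᵥ v) := by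
    intro v
    have h1 : v ⬝ᵥ (M * X + X * Mᵀ) *ᵥ v = 2 * ((Mᵀ *ᵥ v) ⬝ᵥ X *ᵥ v) := by
      have h2 : v ⬝ᵥ M *ᵥ (X *ᵥ v) = (Mᵀ *ᵥ v) ⬝ᵥ X *ᵥ v := by
        rw [← dotProduct_mulVec_transpose, Matrix.transpose_transpose]
      have h3 : v ⬝ᵥ X *ᵥ (Mᵀ *ᵥ v) = (Mᵀ *ᵥ v) ⬝ᵥ X *ᵥ v := by
        conv_lhs => rw [← hX.1]
        rw [dotProduct_mulVec_transpose, dotProduct_comm]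
      rw [Matrix.add_mulVec, dotProduct_add, ← Matrix.mulVec_mulVec, ← Matrix.mulVec_mulVec, h2, h3]
      ring
    rw [← h1, h, Matrix.neg_mulVec, dotProduct_neg]
  have hsymm : x ⬝ᵥ X *ᵥ y = y ⬝ᵥ X *ᵥ x := by
    conv_lhs => rw [← hX.1]
    rw [dotProduct_mulVec_transpose, dotProduct_comm]
  have h1 := hform x
  have h2 := hform y
  rw [hx, sub_dotProduct, smul_dotProduct, smul_dotProduct, smul_eq_mul, smul_eq_mul] at h1
  rw [hy, add_dotProduct, smul_dotProduct, smul_dotProduct, smul_eq_mul, smul_eq_mul, hsymm] at h2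
  have h3 : 0 < x ⬝ᵥ Q *ᵥ x + y ⬝ᵥ Q *ᵥ y := by
    have hx0 := (posSemidef_iff_real.1 hQ.posSemidef).2 x
    have hy0 := (posSemidef_iff_real.1 hQ.posSemidef).2 y
    rcases hxy with hx1 | hy1
    · linarith [(posDef_iff_real.1 hQ).2 x hx1]
    · linarith [(posDef_iff_real.1 hQ).2 y hy1]
  have h4 := hX.2 x
  have h5 := hX.2 y
  by_contra! hre
  have := mul_nonneg hre (add_nonneg h4 h5)
  linarith

lemma IsStable.exists_norm_exp_le (hn : 0 < n) {M : Matrix (Fin n) (Fin n) ℝ} (h : IsStable M) :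
    ∃ K γ : ℝ, 0 < γ ∧ ∀ t : ℝ, 0 ≤ t →
      ‖NormedSpace.exp (t • M)‖ ≤ K * Real.exp (-γ * t) := by
  have h0 : spectralAbscissa M < 0 := spectralAbscissa_lt hn h
  obtain ⟨K, hK⟩ := KalmanBucy.exists_norm_exp_le hn (M := M) (c := -(-spectralAbscissa M / 2))
    fun z hz => (re_le_spectralAbscissa hz).trans_lt (by linarith)
  exact ⟨K, _, by linarith, hK⟩

lemma IsStable.tendsto_exp (hn : 0 < n) {M : Matrix (Fin n) (Fin n) ℝ} (h : IsStable M) :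
    Tendsto (fun t : ℝ => NormedSpace.exp (t • M)) atTop (𝓝 0) := by
  obtain ⟨K, γ, hγ, hK⟩ := h.exists_norm_exp_le hn
  refine squeeze_zero_norm' ((eventually_ge_atTop 0).mono hK) ?_
  have h1 : Tendsto (fun t : ℝ => Real.exp (-γ * t)) atTop (𝓝 0) :=
    Real.tendsto_exp_atBot.comp (tendsto_id.const_mul_atTop_of_neg (by linarith))
  simpa using h1.const_mul K

lemma hasDerivAt_exp_conj (M N X : Matrix (Fin n) (Fin n) ℝ) (t : ℝ) :
    HasDerivAt (fun t : ℝ => NormedSpace.exp (t • M) * X * NormedSpace.exp (t • N))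
      (NormedSpace.exp (t • M) * (M * X + X * N) * NormedSpace.exp (t • N)) t := by
  refine (((hasDerivAt_exp_smul M t).mul_const X).fun_mul
    (hasDerivAt_exp_smul' N t)).congr_deriv ?_
  noncomm_ring

lemma IsStable.tendsto_exp_conj (hn : 0 < n) {M N : Matrix (Fin n) (Fin n) ℝ} (hM : IsStable M)
    (hN : IsStable N) (X : Matrix (Fin n) (Fin n) ℝ) :
    Tendsto (fun t : ℝ => NormedSpace.exp (t • M) * X * NormedSpace.exp (t • Nᵀ)) atTop (𝓝 0) := by
  have hN' : IsStable Nᵀ := IsStable.of_transpose (by rwa [Matrix.transpose_transpose])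
  simpa using ((hM.tendsto_exp hn).mul_const X).mul (hN'.tendsto_exp hn)

lemma IsStable.eq_zero_of_sylvester (hn : 0 < n) {M N X : Matrix (Fin n) (Fin n) ℝ}
    (hM : IsStable M) (hN : IsStable N) (h : M * X + X * Nᵀ = 0) : X = 0 := by
  have hd : ∀ t : ℝ, HasDerivAt
      (fun t : ℝ => NormedSpace.exp (t • M) * X * NormedSpace.exp (t • Nᵀ)) 0 t := fun t => by
    simpa [h] using hasDerivAt_exp_conj M Nᵀ X t
  have hconst : ∀ t : ℝ, NormedSpace.exp (t • M) * X * NormedSpace.exp (t • Nᵀ) = X := fun t => by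
    have := is_const_of_deriv_eq_zero (fun t => (hd t).differentiableAt)
      (fun t => (hd t).deriv) t 0
    simpa using this
  have h1 := hM.tendsto_exp_conj hn hN X
  simp only [hconst] at h1
  exact tendsto_nhds_unique tendsto_const_nhds h1

lemma IsStable.posSemidef_of_lyapunov (hn : 0 < n) {M X Q : Matrix (Fin n) (Fin n) ℝ}
    (hM : IsStable M) (hX : Xᵀ = X) (hQ : Q.PosSemidef) (h : M * X + X * Mᵀ = -Q) :
    X.PosSemidef := by
  refine posSemidef_iff_real.2 ⟨hX, fun x => ?_⟩
  set f : ℝ → ℝ := fun t =>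
    x ⬝ᵥ (NormedSpace.exp (t • M) * X * NormedSpace.exp (t • Mᵀ)) *ᵥ x with hf
  have hmono : MonotoneOn (fun t => -f t) (Ici 0) :=
    monotoneOn_Ici_of_hasDerivWithinAt
      (fun t _ => (hasDerivWithinAt_form
        (hasDerivAt_exp_conj M Mᵀ X t).hasDerivWithinAt x x).fun_neg)
      (fun t _ => by
        have h1 := hQ.mul_mul_conjTranspose_same (NormedSpace.exp (t • M))
        rw [Matrix.conjTranspose_eq_transpose_of_trivial, ← exp_smul_transpose] at h1
        have h2 := (posSemidef_iff_real.1 h1).2 x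
        rw [h, Matrix.mul_neg, Matrix.neg_mul, Matrix.neg_mulVec, dotProduct_neg, neg_neg]
        exact h2)
  have hlim : Tendsto f atTop (𝓝 0) := by
    have := ((formCLM x x).continuous.tendsto 0).comp (hM.tendsto_exp_conj hn hM X)
    rwa [map_zero] at this
  have h0 : f 0 = x ⬝ᵥ X *ᵥ x := by simp [hf]
  rw [← h0]
  refine le_of_tendsto hlim ((eventually_ge_atTop 0).mono fun t ht => ?_)
  have := hmono (mem_Ici.2 le_rfl) (mem_Ici.2 ht) ht
  simpa using this

lemma IsStable.exists_lyapunov (hn : 0 < n) {M Q : Matrix (Fin n) (Fin n) ℝ}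
    (hM : IsStable M) (hQ : Q.PosSemidef) :
    ∃ X : Matrix (Fin n) (Fin n) ℝ, X.PosSemidef ∧ M * X + X * Mᵀ = -Q := by
  let L : Matrix (Fin n) (Fin n) ℝ →ₗ[ℝ] Matrix (Fin n) (Fin n) ℝ :=
    LinearMap.mulLeft ℝ M + LinearMap.mulRight ℝ Mᵀ
  have hL : ∀ X, L X = M * X + X * Mᵀ := fun X => rfl
  have hinj : Function.Injective L := by
    rw [injective_iff_map_eq_zero]
    exact fun X hX => hM.eq_zero_of_sylvester hn hM hX
  obtain ⟨X, hX⟩ := LinearMap.injective_iff_surjective.1 hinj (-Q)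
  have hQt := (posSemidef_iff_real.1 hQ).1
  have hXt : Xᵀ = X := by
    refine hinj ?_
    have := congrArg Matrix.transpose hX
    rw [hL, Matrix.transpose_add, Matrix.transpose_mul, Matrix.transpose_mul,
      Matrix.transpose_transpose, Matrix.transpose_neg, hQt] at this
    rw [hX, hL, ← this, add_comm]
  exact ⟨X, hM.posSemidef_of_lyapunov hn hXt hQ hX, hX⟩

end Lyapunov

/-! ### The algebraic Riccati equation -/

section SteadyState

variable {n : ℕ} {A R S : Matrix (Fin n) (Fin n) ℝ}

lemma posSemidef_conj_of_transpose_eq {S X : Matrix (Fin n) (Fin n) ℝ} (hS : S.PosSemidef)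
    (hX : Xᵀ = X) : (X * S * X).PosSemidef := by
  have := hS.mul_mul_conjTranspose_same X
  rwa [Matrix.conjTranspose_eq_transpose_of_trivial, hX] at this

lemma left_mul_add_mul_transpose (hS : Sᵀ = S) {X : Matrix (Fin n) (Fin n) ℝ}
    (hX : Xᵀ = X) (Y : Matrix (Fin n) (Fin n) ℝ) :
    (A - X * S) * Y + Y * (A - X * S)ᵀ = A * Y + Y * Aᵀ - X * S * Y - Y * S * X := by
  rw [Matrix.transpose_sub, Matrix.transpose_mul, hX, hS]
  noncomm_ring

lemma isStable_of_ricc_nonpos (hR : R.PosDef) (hS : S.PosSemidef) {X : Matrix (Fin n) (Fin n) ℝ}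
    (hX : X.PosSemidef) (hr : (-ricc A R S X).PosSemidef) : IsStable (A - X * S) := by
  have hXt := (posSemidef_iff_real.1 hX).1
  refine isStable_of_lyapunov hX
    (Matrix.PosDef.posSemidef_add (hr.add (posSemidef_conj_of_transpose_eq hS hXt)) hR) ?_
  rw [left_mul_add_mul_transpose (posSemidef_iff_real.1 hS).1 hXt, ricc]
  abel

/-- One step of the Newton (Kleinman) iteration for the algebraic Riccati equation: it starts at any
stabilizing `X` and returns a positive semi-definite subsolution. -/
lemma exists_newton_step (hn : 0 < n) (hR : R.PosDef) (hS : S.PosSemidef)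
    {X : Matrix (Fin n) (Fin n) ℝ} (hX : Xᵀ = X) (hM : IsStable (A - X * S)) :
    ∃ Y : Matrix (Fin n) (Fin n) ℝ, Y.PosSemidef ∧ (-ricc A R S Y).PosSemidef ∧
      (A - X * S) * (X - Y) + (X - Y) * (A - X * S)ᵀ = ricc A R S X := by
  obtain ⟨Y, hY, hYeq⟩ := hM.exists_lyapunov hn
    ((posSemidef_conj_of_transpose_eq hS hX).add hR.posSemidef)
  have hSt := (posSemidef_iff_real.1 hS).1
  have hYt := (posSemidef_iff_real.1 hY).1
  rw [left_mul_add_mul_transpose hSt hX] at hYeq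
  refine ⟨Y, hY, ?_, ?_⟩
  · have h1 : -ricc A R S Y = (Y - X) * S * (Y - X) := by
      have h2 : A * Y + Y * Aᵀ = -(X * S * X + R) + X * S * Y + Y * S * X := by
        rw [← hYeq]; abel
      rw [ricc, h2]
      noncomm_ring
    rw [h1]
    exact posSemidef_conj_of_transpose_eq hS (by rw [Matrix.transpose_sub, hYt, hX])
  · have h1 : (A - X * S) * (X - Y) + (X - Y) * (A - X * S)ᵀ
        = ((A - X * S) * X + X * (A - X * S)ᵀ) - ((A - X * S) * Y + Y * (A - X * S)ᵀ) := by
      noncomm_ring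
    rw [h1, left_mul_add_mul_transpose hSt hX, left_mul_add_mul_transpose hSt hX, hYeq, ricc]
    abel

lemma abs_apply_le_trace {X : Matrix (Fin n) (Fin n) ℝ} (hX : X.PosSemidef) (i j : Fin n) :
    |X i j| ≤ X.trace := by
  obtain ⟨hXt, hX'⟩ := posSemidef_iff_real.1 hX
  have hdiag : ∀ i, X i i ≤ X.trace := fun i =>
    Finset.single_le_sum (f := fun i => X i i) (fun i _ => hX.diag_nonneg) (Finset.mem_univ i)
  have hij : X j i = X i j := congrFun (congrFun hXt i) j
  have hi := hdiag i
  have hj := hdiag j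
  have h1 := hX' (Pi.single i 1 + Pi.single j 1)
  have h2 := hX' (Pi.single i 1 - Pi.single j 1)
  simp [Matrix.mulVec_add, Matrix.mulVec_sub, hij] at h1 h2
  rw [abs_le]
  constructor <;> linarith

lemma isClosed_posSemidef : IsClosed {X : Matrix (Fin n) (Fin n) ℝ | X.PosSemidef} := by
  have h1 : {X : Matrix (Fin n) (Fin n) ℝ | X.PosSemidef}
      = {X | Xᵀ = X} ∩ ⋂ x : Fin n → ℝ, {X | 0 ≤ formCLM x x X} := by
    ext X
    simp only [mem_ofPred_eq, posSemidef_iff_real, mem_inter_iff, mem_iInter]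
    rfl
  rw [h1]
  refine (isClosed_eq (transposeCLM (ι := Fin n)).continuous continuous_id).inter
    (isClosed_iInter fun x => isClosed_le continuous_const (formCLM x x).continuous)

/-- A subsolution of least trace is a solution: otherwise a Newton step would lower its trace. -/
lemma exists_isSteadyState_of_stabilizing (hn : 0 < n) (hR : R.PosDef) (hS : S.PosSemidef)
    {X : Matrix (Fin n) (Fin n) ℝ} (hX : Xᵀ = X) (hM : IsStable (A - X * S)) :
    ∃ P : Matrix (Fin n) (Fin n) ℝ, IsSteadyState A R S P := by
  obtain ⟨Y, hY, hYr, -⟩ := exists_newton_step hn hR hS hX hM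
  set K : Set (Matrix (Fin n) (Fin n) ℝ) :=
    {Z | Z.PosSemidef ∧ (-ricc A R S Z).PosSemidef ∧ Z.trace ≤ Y.trace} with hK
  have htr : Continuous fun Z : Matrix (Fin n) (Fin n) ℝ => Z.trace := by fun_prop
  have hclosed : IsClosed K := by
    have hric : Continuous fun Z : Matrix (Fin n) (Fin n) ℝ => -ricc A R S Z := by
      unfold ricc
      fun_prop
    exact isClosed_posSemidef.inter ((isClosed_posSemidef.preimage hric).inter
      (isClosed_le htr continuous_const))
  have hcompact : IsCompact K := by
    have hbox : IsCompact (Set.pi univ fun _ : Fin n => Set.pi univ fun _ : Fin n =>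
        Icc (-Y.trace) Y.trace) :=
      isCompact_univ_pi fun _ => isCompact_univ_pi fun _ => isCompact_Icc
    refine hbox.of_isClosed_subset hclosed fun Z hZ i _ j _ => ?_
    exact abs_le.1 ((abs_apply_le_trace hZ.1 i j).trans hZ.2.2)
  obtain ⟨P, hPK, hPmin⟩ := hcompact.exists_isMinOn ⟨Y, hY, hYr, le_rfl⟩ htr.continuousOn
  have hPt := (posSemidef_iff_real.1 hPK.1).1
  have hPst := isStable_of_ricc_nonpos hR hS hPK.1 hPK.2.1
  obtain ⟨Z, hZ, hZr, hZeq⟩ := exists_newton_step hn hR hS hPt hPst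
  have hD : (P - Z).PosSemidef := hPst.posSemidef_of_lyapunov hn
    (by rw [Matrix.transpose_sub, hPt, (posSemidef_iff_real.1 hZ).1]) hPK.2.1
    (by rw [hZeq, neg_neg])
  have h1 : (P - Z).trace = 0 := by
    have h2 := hD.trace_nonneg
    rw [Matrix.trace_sub] at h2 ⊢
    have h3 : P.trace ≤ Z.trace := hPmin ⟨hZ, hZr, by linarith [hPK.2.2]⟩
    linarith
  rw [hD.trace_eq_zero_iff] at h1
  refine ⟨P, hPK.1, ?_⟩
  rw [← hZeq, h1]
  simp

lemma IsSteadyState.isStable (hR : R.PosDef) (hS : S.PosSemidef) {P : Matrix (Fin n) (Fin n) ℝ}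
    (hP : IsSteadyState A R S P) : IsStable (A - P * S) :=
  isStable_of_ricc_nonpos hR hS hP.1 (by rw [hP.2, neg_zero]; exact Matrix.PosSemidef.zero)

lemma IsSteadyState.unique (hn : 0 < n) (hR : R.PosDef) (hS : S.PosSemidef)
    {P Q : Matrix (Fin n) (Fin n) ℝ} (hP : IsSteadyState A R S P) (hQ : IsSteadyState A R S Q) :
    P = Q := by
  rw [← sub_eq_zero]
  refine (hP.isStable hR hS).eq_zero_of_sylvester hn (hQ.isStable hR hS) ?_
  have h1 := ricc_sub_ricc (A := A) (R := R) (S := S) P Q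
  rw [hP.2, hQ.2, sub_zero] at h1
  rw [Matrix.transpose_sub, Matrix.transpose_mul, (posSemidef_iff_real.1 hQ.1).1,
    (posSemidef_iff_real.1 hS).1]
  exact h1.symm

/-- The inverse of the discounted observability Gramian `∫₀^υ e^{-s} e^{-A's} S e^{-As} ds` is a
stabilizing gain; the discount factor makes the Lyapunov inequality strict. -/
lemma exists_stabilizing (hS : S.PosSemidef) {υ ϖ : ℝ} (hυ : 0 < υ) (hϖ : 0 < ϖ)
    (hobs : (obsGramian A S υ - ϖ • (1 : Matrix (Fin n) (Fin n) ℝ)).PosSemidef) :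
    ∃ X : Matrix (Fin n) (Fin n) ℝ, Xᵀ = X ∧ IsStable (A - X * S) := by
  have hSt := (posSemidef_iff_real.1 hS).1
  set G : ℝ → Matrix (Fin n) (Fin n) ℝ := fun s =>
    NormedSpace.exp ((-s) • Aᵀ) * S * NormedSpace.exp ((-s) • A) with hG
  have hGpsd : ∀ s, (G s).PosSemidef := fun s => by
    have h1 := hS.conjTranspose_mul_mul_same (NormedSpace.exp ((-s) • A))
    rwa [Matrix.conjTranspose_eq_transpose_of_trivial, ← exp_smul_transpose] at h1
  have hG' : ∀ s, HasDerivAt G (-(Aᵀ * G s) - G s * A) s := fun s => by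
    have h1 := (hasDerivAt_exp_conj Aᵀ A S (-s)).scomp s (hasDerivAt_neg s)
    refine h1.congr_deriv ?_
    have h2 : Commute Aᵀ (NormedSpace.exp ((-s) • Aᵀ)) :=
      ((Commute.refl _).smul_right _).exp_right
    have h3 : Commute A (NormedSpace.exp ((-s) • A)) :=
      ((Commute.refl _).smul_right _).exp_right
    rw [neg_one_smul, sub_eq_add_neg, ← neg_add]
    congr 1
    simp only [hG]
    rw [Matrix.mul_assoc _ _ A, ← h3.eq, ← Matrix.mul_assoc Aᵀ, ← Matrix.mul_assoc Aᵀ, h2.eq]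
    noncomm_ring
  set F : ℝ → Matrix (Fin n) (Fin n) ℝ := fun s => Real.exp (-s) • G s with hF
  have hF' : ∀ s, HasDerivAt F (-(Aᵀ * F s) - F s * A - F s) s := fun s => by
    have h1 : HasDerivAt (fun s : ℝ => Real.exp (-s)) (-Real.exp (-s)) s := by
      simpa using (hasDerivAt_neg s).exp
    refine (h1.fun_smul (hG' s)).congr_deriv ?_
    simp only [hF, smul_sub, smul_neg, neg_smul, Matrix.mul_smul, Matrix.smul_mul]
    abel
  have hGc : Continuous G := continuous_iff_continuousAt.2 fun s => (hG' s).continuousAt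
  have hFc : Continuous F := continuous_iff_continuousAt.2 fun s => (hF' s).continuousAt
  set W : Matrix (Fin n) (Fin n) ℝ := ∫ s in (0 : ℝ)..υ, F s with hW
  have hWform : ∀ x, x ⬝ᵥ W *ᵥ x = ∫ s in (0 : ℝ)..υ, x ⬝ᵥ F s *ᵥ x := fun x =>
    ((formCLM x x).intervalIntegral_comp_comm (hFc.intervalIntegrable _ _)).symm
  have hOform : ∀ x, x ⬝ᵥ obsGramian A S υ *ᵥ x = ∫ s in (0 : ℝ)..υ, x ⬝ᵥ G s *ᵥ x := fun x =>
    ((formCLM x x).intervalIntegral_comp_comm (hGc.intervalIntegrable _ _)).symm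
  have hFt : ∀ s, (F s)ᵀ = F s := fun s => by
    simp only [hF, Matrix.transpose_smul, (posSemidef_iff_real.1 (hGpsd s)).1]
  have hWt : Wᵀ = W := by
    have h1 := (transposeCLM (ι := Fin n)).intervalIntegral_comp_comm
      (hFc.intervalIntegrable (μ := MeasureTheory.volume) 0 υ)
    have h2 : ∀ s, transposeCLM (F s) = F s := hFt
    simp only [h2] at h1
    exact h1.symm
  have hWpos : W.PosDef := by
    refine posDef_iff_real.2 ⟨hWt, fun x hx => ?_⟩
    have h1 : Real.exp (-υ) * (x ⬝ᵥ obsGramian A S υ *ᵥ x) ≤ x ⬝ᵥ W *ᵥ x := by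
      rw [hWform, hOform, ← intervalIntegral.integral_const_mul]
      refine intervalIntegral.integral_mono_on hυ.le
        (((formCLM x x).continuous.comp hGc).const_smul (Real.exp (-υ)) |>.intervalIntegrable _ _)
        (((formCLM x x).continuous.comp hFc).intervalIntegrable _ _) fun s hs => ?_
      simp only [hF, Matrix.smul_mulVec, dotProduct_smul, smul_eq_mul]
      refine mul_le_mul_of_nonneg_right (Real.exp_le_exp.2 (neg_le_neg hs.2)) ?_
      exact (posSemidef_iff_real.1 (hGpsd s)).2 x
    have h2 := (posSemidef_iff_real.1 hobs).2 x
    rw [Matrix.sub_mulVec, dotProduct_sub, Matrix.smul_mulVec, Matrix.one_mulVec, dotProduct_smul,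
      smul_eq_mul] at h2
    have h3 := mul_pos hϖ (dotProduct_self_pos hx)
    have h4 := mul_pos (Real.exp_pos (-υ)) (h3.trans_le (sub_nonneg.1 h2))
    linarith
  have hWeq : Aᵀ * W + W * A = S - F υ - W := by
    have h1 := intervalIntegral.integral_eq_sub_of_hasDerivAt (a := 0) (b := υ) (fun s _ => hF' s)
      (Continuous.intervalIntegrable (by fun_prop) _ _)
    have h2 : ∫ s in (0 : ℝ)..υ, (-(Aᵀ * F s) - F s * A - F s) = -(Aᵀ * W) - W * A - W :=
      (LinearMap.toContinuousLinearMap (-LinearMap.mulLeft ℝ Aᵀ - LinearMap.mulRight ℝ A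
        - LinearMap.id)).intervalIntegral_comp_comm (hFc.intervalIntegrable _ _)
    have h3 : F 0 = S := by simp [hF, hG]
    rw [h2, h3] at h1
    have h4 : Aᵀ * W + W * A = -(-(Aᵀ * W) - W * A - W) - W := by abel
    rw [h4, h1]
    abel
  have hWdet : IsUnit W.det := (Matrix.isUnit_iff_isUnit_det W).1 hWpos.isUnit
  have hWit : W⁻¹ᵀ = W⁻¹ := by rw [Matrix.transpose_nonsing_inv, hWt]
  refine ⟨W⁻¹, hWit, IsStable.of_transpose (isStable_of_lyapunov hWpos.posSemidef
    (Q := W + (S + F υ)) (hWpos.add_posSemidef (hS.add ((hGpsd υ).smul (Real.exp_pos _).le))) ?_)⟩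
  rw [Matrix.transpose_transpose, Matrix.transpose_sub, Matrix.transpose_mul, hWit, hSt,
    Matrix.sub_mul, Matrix.mul_sub, Matrix.mul_assoc, Matrix.nonsing_inv_mul _ hWdet,
    ← Matrix.mul_assoc, Matrix.mul_nonsing_inv _ hWdet, Matrix.mul_one, Matrix.one_mul]
  have h4 : Aᵀ * W - S + (W * A - S) = (Aᵀ * W + W * A) - S - S := by abel
  rw [h4, hWeq]
  abel

end SteadyState

/-! ### Exponential stability of Riccati flows -/

section Stability

variable {n : ℕ} {A R S : Matrix (Fin n) (Fin n) ℝ}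

lemma exists_coercive_of_posDef {N : Matrix (Fin n) (Fin n) ℝ} (hN : N.PosDef) :
    ∃ δ : ℝ, 0 < δ ∧ ∀ x : Fin n → ℝ, δ * (x ⬝ᵥ x) ≤ x ⬝ᵥ N *ᵥ x := by
  have hdet : IsUnit N.det := (Matrix.isUnit_iff_isUnit_det N).1 hN.isUnit
  set s : ℝ := (‖N⁻¹‖ + 1)⁻¹ with hs
  have hs0 : 0 < s := by positivity
  have hs1 : s * ‖N⁻¹‖ ≤ 1 := by
    rw [hs, inv_mul_le_iff₀ (by positivity)]
    linarith
  refine ⟨s, hs0, fun x => ?_⟩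
  -- nonnegativity of the form at `x - s N⁻¹ x`
  set u := N⁻¹ *ᵥ x with hu
  have hNu : N *ᵥ u = x := by
    rw [hu, Matrix.mulVec_mulVec, Matrix.mul_nonsing_inv _ hdet, Matrix.one_mulVec]
  have hNt := (posDef_iff_real.1 hN).1
  have huN : u ⬝ᵥ N *ᵥ x = x ⬝ᵥ x := by
    conv_lhs => rw [← hNt]
    rw [dotProduct_mulVec_transpose, hNu]
  have h1 := (posSemidef_iff_real.1 hN.posSemidef).2 (x - s • u)
  rw [Matrix.mulVec_sub, Matrix.mulVec_smul, hNu, sub_dotProduct, dotProduct_sub, dotProduct_sub,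
    smul_dotProduct, smul_dotProduct, dotProduct_smul, dotProduct_smul, huN, dotProduct_comm u x]
    at h1
  simp only [smul_eq_mul] at h1
  have h2 := (le_abs_self _).trans (abs_dotProduct_mulVec_le N⁻¹ x x)
  rw [← sq, norm_toLp_sq, ← hu] at h2
  have hxx : 0 ≤ x ⬝ᵥ x := by rw [← norm_toLp_sq]; positivity
  have h3 := mul_le_mul_of_nonneg_left h2 (mul_pos hs0 hs0).le
  have h4 := mul_le_mul_of_nonneg_right hs1 (mul_nonneg hs0.le hxx)
  linarith

lemma mul_le_of_quadratic_le {δ p c w y : ℝ} (hδ : 0 < δ) (hp : 0 ≤ p) (hc : 0 ≤ c) (hy : 0 ≤ y)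
    (h : δ * w ^ 2 ≤ p * y ^ 2 + c * (w * y)) : w ≤ ((p + c) / δ + 1) * y := by
  by_contra! hlt
  have h0 : 0 ≤ (p + c) / δ := by positivity
  have hyw : y ≤ w := by nlinarith
  have hw0 : 0 < w := lt_of_le_of_lt (by positivity) hlt
  have h1 : p * y ^ 2 ≤ p * (w * y) := by
    refine mul_le_mul_of_nonneg_left ?_ hp
    nlinarith
  have h2 : δ * w ≤ (p + c) * y := by
    refine le_of_mul_le_mul_right (a := w) ?_ hw0
    linarith
  have h3 : δ * (((p + c) / δ + 1) * y) = (p + c) * y + δ * y := by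
    field_simp
  have h4 := mul_lt_mul_of_pos_left hlt hδ
  have h5 : 0 ≤ δ * y := by positivity
  linarith

/-- The transition matrix of a Riccati flow is bounded. Let `X` be the inverse transpose of `E`. The
forms `X' P_t X` increase strictly in `t`, so they dominate a positive definite form for `t ≥ 1`; on
the other hand `P_t` differs from the steady state by `E_t (P_0 - P) e^{t (A - P S)'}`, which is
only linear in `E_t`. -/
lemma IsRiccatiFlow.exists_norm_transition_le (hn : 0 < n) (hR : R.PosDef) (hS : S.PosSemidef)
    {P : Matrix (Fin n) (Fin n) ℝ} (hP : IsSteadyState A R S P)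
    {Q E X : ℝ → Matrix (Fin n) (Fin n) ℝ} (hQ : IsRiccatiFlow A R S Q)
    (hE : IsTransitionMatrix A S Q E) (hX0 : X 0 = 1)
    (hX : ∀ t, 0 ≤ t → HasDerivWithinAt X (-((A - Q t * S)ᵀ * X t)) (Ici 0) t)
    (hXE : ∀ t, 0 ≤ t → X t * (E t)ᵀ = 1) :
    ∃ C : ℝ, ∀ t, 0 ≤ t → ‖E t‖ ≤ C := by
  have hRt := (posSemidef_iff_real.1 hR.posSemidef).1
  have hSt := (posSemidef_iff_real.1 hS).1
  obtain ⟨K, γ, hγ, hK⟩ := (hP.isStable hR hS).exists_norm_exp_le hn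
  have hK0 : 0 ≤ K := by simpa using (norm_nonneg _).trans (hK 0 le_rfl)
  set N : ℝ → Matrix (Fin n) (Fin n) ℝ := fun t => (X t)ᵀ * Q t * X t with hN
  have hN' : ∀ t, 0 ≤ t → HasDerivWithinAt N ((X t)ᵀ * (Q t * S * Q t + R) * X t) (Ici 0) t := by
    intro t ht
    refine (((hasDerivWithinAt_transpose (hX t ht)).fun_mul (hQ.hasDerivWithinAt t ht)).fun_mul
      (hX t ht)).congr_deriv ?_
    simp only [Matrix.transpose_neg, Matrix.transpose_mul, Matrix.transpose_transpose,
      Matrix.transpose_sub, hSt, hQ.transpose_eq hRt hSt ht, ricc]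
    noncomm_ring
  have hform : ∀ t x, x ⬝ᵥ N t *ᵥ x = (X t *ᵥ x) ⬝ᵥ Q t *ᵥ (X t *ᵥ x) := fun t x => by
    simp only [hN]
    rw [← Matrix.mulVec_mulVec, ← Matrix.mulVec_mulVec, dotProduct_mulVec_transpose]
  have hmono : ∀ x, x ≠ 0 → StrictMonoOn (fun t => x ⬝ᵥ N t *ᵥ x) (Ici 0) := by
    intro x hx
    refine strictMonoOn_Ici_of_hasDerivWithinAt
      (fun t ht => hasDerivWithinAt_form (hN' t ht) x x) fun t ht => ?_
    have hne : X t *ᵥ x ≠ 0 := by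
      intro h0
      apply hx
      have := congrArg (fun v => (E t)ᵀ *ᵥ v) h0
      simpa [Matrix.mulVec_mulVec, mul_eq_one_comm.1 (hXE t ht)] using this
    rw [← Matrix.mulVec_mulVec, ← Matrix.mulVec_mulVec, dotProduct_mulVec_transpose]
    exact (posDef_iff_real.1 (Matrix.PosDef.posSemidef_add
      (posSemidef_conj_of_transpose_eq hS (hQ.transpose_eq hRt hSt ht)) hR)).2 _ hne
  have hN1 : (N 1).PosDef := by
    refine posDef_iff_real.2 ⟨?_, fun x hx => ?_⟩
    · simp only [hN]
      rw [Matrix.transpose_mul, Matrix.transpose_mul, Matrix.transpose_transpose,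
        hQ.transpose_eq hRt hSt zero_le_one, Matrix.mul_assoc]
    · have h1 := hmono x hx (mem_Ici.2 le_rfl) (mem_Ici.2 zero_le_one) zero_lt_one
      have h2 := (posSemidef_iff_real.1 hQ.posSemidef_zero).2 x
      simp only [hform 0, hX0, Matrix.one_mulVec] at h1
      linarith
  obtain ⟨δ, hδ, hδN⟩ := exists_coercive_of_posDef hN1
  obtain ⟨D, hD⟩ := (isCompact_Icc (a := (0 : ℝ)) (b := 1)).bddAbove_image
    (hE.continuousOn.norm.mono Icc_subset_Ici_self)
  refine ⟨max D ((‖P‖ + ‖Q 0 - P‖ * K) / δ + 1), fun t ht => ?_⟩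
  rcases le_total t 1 with ht1 | ht1
  · exact (hD (mem_image_of_mem _ ⟨ht, ht1⟩)).trans (le_max_left _ _)
  refine le_trans ?_ (le_max_right _ _)
  rw [← l2_opNorm_transpose]
  refine l2_opNorm_le_of_forall_norm_toLp (by positivity) fun y => ?_
  set x := (E t)ᵀ *ᵥ y with hx
  have hXx : X t *ᵥ x = y := by rw [hx, Matrix.mulVec_mulVec, hXE t ht, Matrix.one_mulVec]
  refine mul_le_of_quadratic_le hδ (norm_nonneg P) (mul_nonneg (norm_nonneg (Q 0 - P)) hK0)
    (norm_nonneg _) ?_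
  have h1 : x ⬝ᵥ N 1 *ᵥ x ≤ x ⬝ᵥ N t *ᵥ x := by
    rcases eq_or_ne x 0 with h0 | h0
    · simp [h0]
    · exact (hmono x h0).monotoneOn (mem_Ici.2 zero_le_one) (mem_Ici.2 ht) ht1
  have h2 : Q t = P + E t * ((Q 0 - P) * (NormedSpace.exp (t • (A - P * S)))ᵀ) := by
    rw [← Matrix.mul_assoc, ← hQ.sub_eq hRt hSt hP.isRiccatiFlow hE (isTransitionMatrix_exp P) ht]
    abel
  have h3 : y ⬝ᵥ (E t * ((Q 0 - P) * (NormedSpace.exp (t • (A - P * S)))ᵀ)) *ᵥ y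
      = x ⬝ᵥ ((Q 0 - P) * (NormedSpace.exp (t • (A - P * S)))ᵀ) *ᵥ y := by
    rw [← Matrix.mulVec_mulVec, hx, ← dotProduct_mulVec_transpose, Matrix.transpose_transpose]
  have h4 := (le_abs_self _).trans (abs_dotProduct_mulVec_le P y y)
  have h5 := (le_abs_self _).trans (abs_dotProduct_mulVec_le
    ((Q 0 - P) * (NormedSpace.exp (t • (A - P * S)))ᵀ) x y)
  have h6 : ‖(Q 0 - P) * (NormedSpace.exp (t • (A - P * S)))ᵀ‖ ≤ ‖Q 0 - P‖ * K := by
    refine (norm_mul_le _ _).trans (mul_le_mul_of_nonneg_left ?_ (norm_nonneg _))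
    rw [l2_opNorm_transpose]
    refine (hK t ht).trans (mul_le_of_le_one_right hK0 (Real.exp_le_one_iff.2 ?_))
    nlinarith
  have h7 := mul_le_mul_of_nonneg_right h6
    (mul_nonneg (norm_nonneg (WithLp.toLp 2 x)) (norm_nonneg (WithLp.toLp 2 y)))
  have h8 : x ⬝ᵥ N t *ᵥ x = y ⬝ᵥ P *ᵥ y
      + x ⬝ᵥ ((Q 0 - P) * (NormedSpace.exp (t • (A - P * S)))ᵀ) *ᵥ y := by
    rw [hform, hXx, h2, Matrix.add_mulVec, dotProduct_add, h3]
  have h9 := hδN x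
  rw [norm_toLp_sq, sq]
  linarith

/-- A transition matrix inherits the exponential rate of the semigroup at the steady state as soon
as the flow approaches the steady state exponentially. -/
lemma IsRiccatiFlow.norm_transition_le_of_decay {P : Matrix (Fin n) (Fin n) ℝ}
    {Q E : ℝ → Matrix (Fin n) (Fin n) ℝ} (hQ : IsRiccatiFlow A R S Q)
    (hE : IsTransitionMatrix A S Q E) {k l c γ : ℝ}
    (hM : ∀ t : ℝ, 0 ≤ t → ‖NormedSpace.exp (t • (A - P * S))‖ ≤ k * Real.exp (l * t))
    (hc : 0 ≤ c) (hγ : 0 < γ) (hQP : ∀ t, 0 ≤ t → ‖Q t - P‖ ≤ c * Real.exp (-(γ * t)))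
    {t : ℝ} (ht : 0 ≤ t) :
    ‖E t‖ ≤ k * Real.exp (k * (c * ‖S‖) / γ) * Real.exp (l * t) := by
  refine norm_le_of_perturbed_ode (B := fun t => (P - Q t) * S) hM
    ((continuousOn_const.sub hQ.continuousOn).mul continuousOn_const) (by positivity) hγ
    (fun s hs => ?_) hE.zero (fun s hs => ?_) ht
  · refine (norm_mul_le _ _).trans ?_
    rw [norm_sub_rev, mul_right_comm]
    exact mul_le_mul_of_nonneg_right (hQP s hs) (norm_nonneg S)
  · refine (hE.hasDerivWithinAt s hs).congr_deriv ?_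
    congr 1
    noncomm_ring

/-- All transition matrices decay at one common rate. -/
lemma exists_transition_decay (hn : 0 < n) (hR : R.PosDef) (hS : S.PosSemidef)
    {P : Matrix (Fin n) (Fin n) ℝ} (hP : IsSteadyState A R S P) :
    ∃ γ : ℝ, 0 < γ ∧ ∀ Q₀ : Matrix (Fin n) (Fin n) ℝ, ∃ C : ℝ,
      ∀ Q : ℝ → Matrix (Fin n) (Fin n) ℝ, IsRiccatiFlow A R S Q → Q 0 = Q₀ →
        ∃ E, IsTransitionMatrix A S Q E ∧ ∀ t, 0 ≤ t → ‖E t‖ ≤ C * Real.exp (-γ * t) := by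
  have hRt := (posSemidef_iff_real.1 hR.posSemidef).1
  have hSt := (posSemidef_iff_real.1 hS).1
  obtain ⟨K, γ, hγ, hK⟩ := (hP.isStable hR hS).exists_norm_exp_le hn
  refine ⟨γ, hγ, fun Q₀ => ?_⟩
  -- flows with the same initial value coincide for `t ≥ 0`, so one of them determines the constant
  by_cases hex : ∃ Q, IsRiccatiFlow A R S Q ∧ Q 0 = Q₀
  swap
  · exact ⟨0, fun Q hQ h0 => (hex ⟨Q, hQ, h0⟩).elim⟩
  obtain ⟨Q, hQ, h0⟩ := hex
  obtain ⟨E, X, hE, hX0, hX, hXE⟩ := hQ.exists_isTransitionMatrix hRt hSt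
  obtain ⟨D, hD⟩ := hQ.exists_norm_transition_le hn hR hS hP hE hX0 hX hXE
  have hD0 : 0 ≤ D := (norm_nonneg _).trans (hD 0 le_rfl)
  have hK0 : 0 ≤ K := by simpa using (norm_nonneg _).trans (hK 0 le_rfl)
  have hQP : ∀ t, 0 ≤ t → ‖Q t - P‖ ≤ D * K * ‖Q 0 - P‖ * Real.exp (-(γ * t)) := by
    intro t ht
    refine (hQ.norm_sub_le hRt hSt hP.isRiccatiFlow hE (isTransitionMatrix_exp P) ht).trans ?_
    have h1 := hD t ht
    have h2 := hK t ht
    calc _ ≤ D * (K * Real.exp (-γ * t)) * ‖Q 0 - P‖ := by gcongr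
      _ = _ := by rw [neg_mul]; ring
  refine ⟨_, fun Q' hQ' h0' => ⟨E, ⟨hE.zero, fun t ht => ?_⟩, fun t ht =>
    hQ.norm_transition_le_of_decay hE hK (by positivity) hγ hQP ht⟩⟩
  rw [hQ'.unique hQ (h0'.trans h0.symm) ht]
  exact hE.hasDerivWithinAt t ht

lemma exists_isBucyConstants (hn : 0 < n) (hR : R.PosDef) (hS : S.PosSemidef)
    {P : Matrix (Fin n) (Fin n) ℝ} (hP : IsSteadyState A R S P) :
    ∃ α β, IsBucyConstants A R S α β := by
  obtain ⟨γ, hγ, h⟩ := exists_transition_decay hn hR hS hP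
  choose C hC using h
  refine ⟨fun P₀ Q₀ => C P₀ * C Q₀, γ, hγ, fun Q Q' hQ hQ' t ht => ?_⟩
  obtain ⟨E, hE, hEt⟩ := hC _ Q hQ rfl
  obtain ⟨F, hF, hFt⟩ := hC _ Q' hQ' rfl
  refine (hQ.norm_sub_le (posSemidef_iff_real.1 hR.posSemidef).1 (posSemidef_iff_real.1 hS).1 hQ'
    hE hF ht).trans (mul_le_mul_of_nonneg_right ?_ (norm_nonneg _))
  refine (mul_le_mul (hEt t ht) (hFt t ht) (norm_nonneg _)
    ((norm_nonneg _).trans (hEt t ht))).trans_eq ?_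
  have h1 : Real.exp (-(2 * γ * t)) = Real.exp (-γ * t) * Real.exp (-γ * t) := by
    rw [← Real.exp_add]
    ring_nf
  rw [h1]
  ring

/-- Both decay estimates are instances of this one: any exponential bound of the semigroup at the
steady state yields an explicit Lipschitz estimate for Riccati flows with twice the rate. -/
lemma norm_sub_le_of_isBucyConstants (hR : R.PosDef) (hS : S.PosSemidef)
    {P : Matrix (Fin n) (Fin n) ℝ} (hP : IsSteadyState A R S P)
    {α : Matrix (Fin n) (Fin n) ℝ → Matrix (Fin n) (Fin n) ℝ → ℝ} {β : ℝ}
    (hα : IsBucyConstants A R S α β) {k l : ℝ}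
    (hM : ∀ t : ℝ, 0 ≤ t → ‖NormedSpace.exp (t • (A - P * S))‖ ≤ k * Real.exp (l * t))
    {Q Q' : ℝ → Matrix (Fin n) (Fin n) ℝ} (hQ : IsRiccatiFlow A R S Q)
    (hQ' : IsRiccatiFlow A R S Q') {t : ℝ} (ht : 0 ≤ t) :
    ‖Q t - Q' t‖ ≤ kappaSigma P S α β k (Q 0) * kappaSigma P S α β k (Q' 0)
      * Real.exp (2 * l * t) * ‖Q 0 - Q' 0‖ := by
  have hRt := (posSemidef_iff_real.1 hR.posSemidef).1
  have hSt := (posSemidef_iff_real.1 hS).1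
  obtain ⟨hβ, hα⟩ := hα
  have key : ∀ Q : ℝ → Matrix (Fin n) (Fin n) ℝ, IsRiccatiFlow A R S Q →
      ∃ E, IsTransitionMatrix A S Q E ∧
        ‖E t‖ ≤ kappaSigma P S α β k (Q 0) * Real.exp (l * t) := by
    intro Q hQ
    obtain ⟨E, X, hE, -⟩ := hQ.exists_isTransitionMatrix hRt hSt
    refine ⟨E, hE, ?_⟩
    -- the estimate at time `0` forces `α (Q 0) P ≥ 0` unless `Q 0 = P`
    have hc : 0 ≤ α (Q 0) P * ‖Q 0 - P‖ := by
      have := (norm_nonneg _).trans (hα Q _ hQ hP.isRiccatiFlow 0 le_rfl)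
      simpa using this
    refine (hQ.norm_transition_le_of_decay hE hM hc (mul_pos two_pos hβ) (fun s hs => ?_)
      ht).trans_eq ?_
    · rw [mul_right_comm]
      exact hα Q _ hQ hP.isRiccatiFlow s hs
    · rw [kappaSigma]
      congr 3
      ring
  obtain ⟨E, hE, hEt⟩ := key Q hQ
  obtain ⟨F, hF, hFt⟩ := key Q' hQ'
  refine (hQ.norm_sub_le hRt hSt hQ' hE hF ht).trans
    (mul_le_mul_of_nonneg_right ?_ (norm_nonneg _))
  refine (mul_le_mul hEt hFt (norm_nonneg _) ((norm_nonneg _).trans hEt)).trans_eq ?_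
  have h1 : Real.exp (2 * l * t) = Real.exp (l * t) * Real.exp (l * t) := by
    rw [← Real.exp_add]
    ring_nf
  rw [h1]
  ring

lemma posSemidef_obsMatrix {m : ℕ} (C : Matrix (Fin m) (Fin n) ℝ)
    {R₂ : Matrix (Fin m) (Fin m) ℝ} (hR₂ : R₂.PosDef) : (obsMatrix C R₂).PosSemidef := by
  have := hR₂.inv.posSemidef.conjTranspose_mul_mul_same C
  rwa [Matrix.conjTranspose_eq_transpose_of_trivial] at this

end Stability

end KalmanBucy

theorem mainTheorem10 {r₁ r₂ : ℕ} (hr : 0 < r₁)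
    (A : Matrix (Fin r₁) (Fin r₁) ℝ) (C : Matrix (Fin r₂) (Fin r₁) ℝ)
    (R : Matrix (Fin r₁) (Fin r₁) ℝ) (R₂ : Matrix (Fin r₂) (Fin r₂) ℝ)
    (hR : R.PosDef) (hR₂ : R₂.PosDef)
    (S : Matrix (Fin r₁) (Fin r₁) ℝ) (hS : S = KalmanBucy.obsMatrix C R₂)
    (υ ϖm ϖp : ℝ)
    (hobs : KalmanBucy.UniformlyObservableControllable A R S υ ϖm ϖp) :
    -- the steady state `P` exists, is unique, and `A - P S` is asymptotically stable
    ∃ P : Matrix (Fin r₁) (Fin r₁) ℝ,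
      (KalmanBucy.IsSteadyState A R S P ∧
        ∀ P' : Matrix (Fin r₁) (Fin r₁) ℝ, KalmanBucy.IsSteadyState A R S P' → P' = P) ∧
      KalmanBucy.spectralAbscissa (A - P * S) < 0 ∧
      -- the constants of Bucy's estimate and of the matrix exponential bound exist
      (∃ (α : Matrix (Fin r₁) (Fin r₁) ℝ → Matrix (Fin r₁) (Fin r₁) ℝ → ℝ) (β : ℝ),
        KalmanBucy.IsBucyConstants A R S α β) ∧
      (∀ ε : ℝ, 0 < ε → ε ≤ 1 → ∃ k : ℝ, KalmanBucy.IsExpBound (A - P * S) ε k) ∧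
      -- and, for every choice of such constants, both decay estimates hold
      ∀ (α : Matrix (Fin r₁) (Fin r₁) ℝ → Matrix (Fin r₁) (Fin r₁) ℝ → ℝ) (β : ℝ),
        KalmanBucy.IsBucyConstants A R S α β →
        ∀ Pt Qt : ℝ → Matrix (Fin r₁) (Fin r₁) ℝ,
          KalmanBucy.IsRiccatiFlow A R S Pt → KalmanBucy.IsRiccatiFlow A R S Qt →
          (∀ ε k : ℝ, 0 < ε → ε ≤ 1 → KalmanBucy.IsExpBound (A - P * S) ε k →
            ∀ t : ℝ, 0 ≤ t →
              ‖Pt t - Qt t‖ ≤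
                KalmanBucy.kappaSigma P S α β k (Pt 0) * KalmanBucy.kappaSigma P S α β k (Qt 0) *
                  Real.exp (2 * (1 - ε) * KalmanBucy.spectralAbscissa (A - P * S) * t) *
                  ‖Pt 0 - Qt 0‖) ∧
          (∀ t : ℝ, 0 ≤ t →
            ‖Pt t - Qt t‖ ≤
              KalmanBucy.kappaMu P S α β (Pt 0) * KalmanBucy.kappaMu P S α β (Qt 0) *
                Real.exp (2 * KalmanBucy.logNorm (A - P * S) * t) *
                ‖Pt 0 - Qt 0‖) := by
  have hSpsd : S.PosSemidef := hS ▸ KalmanBucy.posSemidef_obsMatrix C hR₂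
  obtain ⟨X, hX, hXst⟩ := KalmanBucy.exists_stabilizing hSpsd hobs.interval_pos hobs.lower_pos
    hobs.obs_lower
  obtain ⟨P, hP⟩ := KalmanBucy.exists_isSteadyState_of_stabilizing hr hR hSpsd hX hXst
  have hst := KalmanBucy.spectralAbscissa_lt hr (hP.isStable hR hSpsd)
  refine ⟨P, ⟨hP, fun P' hP' => hP'.unique hr hR hSpsd hP⟩, hst,
    KalmanBucy.exists_isBucyConstants hr hR hSpsd hP,
    fun ε hε _ => KalmanBucy.exists_isExpBound hr hst hε,
    fun α β hα Pt Qt hPt hQt => ⟨fun ε k _ _ hk t ht => ?_, fun t ht => ?_⟩⟩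
  · have h1 := KalmanBucy.norm_sub_le_of_isBucyConstants hR hSpsd hP hα hk hPt hQt ht
    rwa [← mul_assoc 2] at h1
  · have h1 := KalmanBucy.norm_sub_le_of_isBucyConstants hR hSpsd hP hα (k := 1)
      (fun s hs => by simpa using KalmanBucy.norm_exp_le_logNorm (A - P * S) hs) hPt hQt ht
    simpa only [KalmanBucy.kappaSigma, KalmanBucy.kappaMu, one_mul] using h1
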